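/- For a lattice $\Lambda\subset\mathbb C$ the torus $S=\mathbb C/\Lambda$ is a Riemann surface of genus one. A marked torus $(S,f)$ is such an $S$ with an orientation-preserving homeomorphism $f:S\to S_1=\mathbb C/(\mathbb Z+i\mathbb Z)$. Let $\mathcal T_1$ be the Teichmüller space of the torus: the set of classes $[S,f]$ of marked tori, where $(S,f)\sim(S',f')$ if there is a biholomorphic map $h:S\to S'$ such that $f'\circ h$ is homotopic to $f$. Let $d_S$ be the distance of the flat metric of area $1$ on $S=\mathbb C/\Lambda$, i.e. the Euclidean metric of $\mathbb C$ rescaled so that $S$ has area $1$. Define $$\lambda([S,f],[S',f'])=\inf_{\varphi}\log\mathcal L(\varphi),\qquad \mathcal L(\varphi)=\sup_{x\ne y}\frac{d_{S'}(\varphi(x),\varphi(y))}{d_S(x,y)},$$ the infimum being over all Lipschitz maps $\varphi:S\to S'$ homotopic to $f'^{-1}\circ f$, and $$d_{\mathrm{Teich}}([S,f],[S',f'])=\tfrac12\log\inf_g K_g,\qquad K_g=\sup\frac{|g_z|+|g_{\bar z}|}{|g_z|-|g_{\bar z}|},$$ the infimum being over all homeomorphisms $g:S\to S'$ homotopic to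 $f'^{-1}\circ f$ that are smooth except at finitely many points, and the supremum over all points where $g$ is differentiable. Let $h$ be the Poincaré distance on the upper half-plane $\mathbb H^2$, i.e. the distance of $ds^2=(dx^2+dy^2)/y^2$. **Theorem.** The functions $\lambda$ and $d_{\mathrm{Teich}}$ are well defined and finite on $\mathcal T_1$, and both are (symmetric) metrics. The metric spaces $(\mathcal T_1,\lambda)$, $(\mathcal T_1,d_{\mathrm{Teich}})$ and $(\mathbb H^2,h)$ are isometric up to scalar factors. More precisely, let $\Phi$ send $[S,f]$ with $S=\mathbb C/\Lambda$ to $\omega_2/\omega_1$, where $\omega_1,\omega_2$ is the basis of $\Lambda$ that the marking takes to the basis $1,i$ of $\mathbb Z+i\mathbb Z$, i.e. a lift $F:\mathbb C\to\mathbb C$ of $f$ satisfies $F(z+\omega_1)=F(z)+1$ and $F(z+\omega_2)=F(z)+i$ for all $z$. Then $\Phi$ is a well-defined bijection $\mathcal T_1\to\mathbb H^2$, and for all $x,y\in\mathcal T_1$ $$d_{\mathrm{Teich}}(x,y)=\lambda(x,y),\qquad h(\Phi(x),\Phi(y))=2\,\lambda(x,y).$$ -/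

import Mathlib

open scoped ContDiff UpperHalfPlane

noncomputable section

namespace FlatTorus

/-- The complex torus `ℂ / Λ` (with its quotient topology). -/
abbrev Torus (Λ : Submodule ℤ ℂ) : Type := ℂ ⧸ Λ

/-- The quotient map `ℂ → ℂ / Λ`. -/
abbrev proj (Λ : Submodule ℤ ℂ) (z : ℂ) : Torus Λ := Submodule.Quotient.mk z

/-- The lattice `ℤ + iℤ`; the fixed oriented surface is `ℂ / (ℤ + iℤ)`. -/
def gaussianLattice : Submodule ℤ ℂ := Submodule.span ℤ {1, Complex.I}

/-- `F` is a lift of `g : ℂ / Λ → ℂ / Λ'` to the universal covers. -/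
def IsLift {Λ Λ' : Submodule ℤ ℂ} (g : Torus Λ → Torus Λ') (F : ℂ → ℂ) : Prop :=
  Continuous F ∧ ∀ z, proj Λ' (F z) = g (proj Λ z)

/-- The loop `γ`, considered on `[0, 2π]`, avoids `0` and has winding number `1` around `0`:
it has a continuous argument which increases by `2π`. -/
def WindsOnce (γ : ℝ → ℂ) : Prop :=
  (∀ t, γ t ≠ 0) ∧ ∃ θ : ℝ → ℝ, Continuous θ ∧
    (∀ t, γ t = ‖γ t‖ * Complex.exp (θ t * Complex.I)) ∧
    θ (2 * Real.pi) = θ 0 + 2 * Real.pi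

/-- A homeomorphism of tori preserves the orientation if it has local degree `1` everywhere:
a lift maps every positively oriented circle around a point `z` to a loop
winding once, in the positive direction, around the image of `z`. -/
def OrientationPreserving {Λ Λ' : Submodule ℤ ℂ} (g : Torus Λ ≃ₜ Torus Λ') : Prop :=
  ∃ F : ℂ → ℂ, IsLift g F ∧ ∀ z : ℂ, ∀ r : ℝ, 0 < r →
    WindsOnce fun t : ℝ => F (z + r * Complex.exp (t * Complex.I)) - F z

/-- A map between tori is holomorphic if it lifts to an entire function. -/
def Holomorphic {Λ Λ' : Submodule ℤ ℂ} (g : Torus Λ → Torus Λ') : Prop :=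
  ∃ H : ℂ → ℂ, Differentiable ℂ H ∧ IsLift g H

/-- A marked torus: a closed Riemann surface `S = ℂ / Λ` of genus one, with an
orientation-preserving homeomorphism from `S` to the fixed surface `ℂ / (ℤ + iℤ)`. -/
structure MarkedTorus where
  lattice : Submodule ℤ ℂ
  discrete : DiscreteTopology lattice
  isZLattice : IsZLattice ℝ lattice
  marking : Torus lattice ≃ₜ Torus gaussianLattice
  orientation : OrientationPreserving marking

/-- Two marked tori are equivalent if there is a conformal homeomorphism `h` (biholomorphic map)
between them that commutes with the markings up to homotopy. -/
def MarkedTorus.Equivalent (m n : MarkedTorus) : Prop :=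
  ∃ h : Torus m.lattice ≃ₜ Torus n.lattice, Holomorphic h ∧ Holomorphic h.symm ∧
    ContinuousMap.Homotopic ((h.trans n.marking : Torus m.lattice ≃ₜ Torus gaussianLattice) :
      C(Torus m.lattice, Torus gaussianLattice)) (m.marking : C(_, _))

theorem Holomorphic.comp {Λ Λ' Λ'' : Submodule ℤ ℂ} {g : Torus Λ' → Torus Λ''}
    {f : Torus Λ → Torus Λ'} (hg : Holomorphic g) (hf : Holomorphic f) : Holomorphic (g ∘ f) := by
  obtain ⟨G, hG, hG1, hG2⟩ := hg
  obtain ⟨F, hF, hF1, hF2⟩ := hf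
  exact ⟨G ∘ F, hG.comp hF, hG1.comp hF1, fun z => by simp [hG2, hF2]⟩

theorem holomorphic_id (Λ : Submodule ℤ ℂ) : Holomorphic (id : Torus Λ → Torus Λ) :=
  ⟨id, differentiable_id, continuous_id, fun _ => rfl⟩

theorem MarkedTorus.equivalent_equivalence : Equivalence MarkedTorus.Equivalent where
  refl m := ⟨Homeomorph.refl _, holomorphic_id _, holomorphic_id _, ContinuousMap.Homotopic.refl _⟩
  symm := by
    rintro m n ⟨h, h1, h2, h3⟩
    refine ⟨h.symm, h2, by simpa using h1, ?_⟩
    have h4 := (ContinuousMap.Homotopic.comp h3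
      (ContinuousMap.Homotopic.refl (h.symm : C(Torus n.lattice, Torus m.lattice)))).symm
    have h5 : ((h.trans n.marking : Torus m.lattice ≃ₜ Torus gaussianLattice) :
        C(Torus m.lattice, Torus gaussianLattice)).comp
          (h.symm : C(Torus n.lattice, Torus m.lattice)) = (n.marking : C(_, _)) := by
      apply ContinuousMap.ext
      intro x
      change n.marking (h (h.symm x)) = n.marking x
      rw [h.apply_symm_apply]
    rw [h5] at h4
    exact h4
  trans := by
    rintro m n k ⟨h, h1, h2, h3⟩ ⟨g, g1, g2, g3⟩
    refine ⟨h.trans g, g1.comp h1, h2.comp g2, ?_⟩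
    exact (ContinuousMap.Homotopic.comp g3
      (ContinuousMap.Homotopic.refl (h : C(Torus m.lattice, Torus n.lattice)))).trans h3

instance MarkedTorus.setoid : Setoid MarkedTorus :=
  ⟨MarkedTorus.Equivalent, MarkedTorus.equivalent_equivalence⟩

/-- The Teichmüller space of the torus. -/
def TeichmullerSpace : Type := Quotient MarkedTorus.setoid

/-- The point of Teichmüller space represented by a marked torus. -/
def MarkedTorus.toTeich (m : MarkedTorus) : TeichmullerSpace := Quotient.mk _ m

/-- The distance of the flat metric of area `1` on `ℂ / Λ` that is compatible with the complex
structure. Here `‖x - y‖` is the quotient norm, that is, the minimum of `|z - w|` over all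
points `z` and `w` of `ℂ` above `x` and `y`, and dividing by the square
root of the area of `ℂ / Λ` normalizes the area to `1`. -/
def MarkedTorus.flatDist (m : MarkedTorus) (x y : Torus m.lattice) : ℝ :=
  ‖x - y‖ / Real.sqrt (ZLattice.covolume m.lattice)

/-- The homeomorphism `f'⁻¹ ∘ f : S → S'` determined by the markings. -/
def MarkedTorus.changeOfMarking (m n : MarkedTorus) : Torus m.lattice ≃ₜ Torus n.lattice :=
  m.marking.trans n.marking.symm

/-- The homotopy class of `f'⁻¹ ∘ f`. -/
def MarkedTorus.RespectsMarkings (m n : MarkedTorus) (φ : C(Torus m.lattice, Torus n.lattice)) :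
    Prop :=
  ContinuousMap.Homotopic φ (m.changeOfMarking n : C(_, _))

/-- The (possibly infinite) Lipschitz constant with respect to the area-one flat metrics. -/
def lipConst (m n : MarkedTorus) (φ : Torus m.lattice → Torus n.lattice) : ENNReal :=
  ⨆ (x : Torus m.lattice) (y : Torus m.lattice) (_ : x ≠ y),
    ENNReal.ofReal (n.flatDist (φ x) (φ y) / m.flatDist x y)

/-- Thurston's function `λ`: the infimum of `log L(φ)` over all Lipschitz maps `φ` in the homotopy
class of `f'⁻¹ ∘ f`, as an extended real number. -/
def thurstonLambda (m n : MarkedTorus) : EReal :=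
  ⨅ (φ : C(Torus m.lattice, Torus n.lattice)) (_ : m.RespectsMarkings n φ)
    (_ : lipConst m n φ ≠ ⊤), ENNReal.log (lipConst m n φ)

/-- The dilatation `(|g_z| + |g_z̄|) / (|g_z| - |g_z̄|)` of the real derivative `A` of `g` at a
point, where `g_z = (A 1 - i A i) / 2` and `g_z̄ = (A 1 + i A i) / 2`. It is infinite if
`A ≠ 0` is singular or reverses the orientation; points with `A = 0` are disregarded in the
supremum below, since `0 / 0 = 0`. -/
def dilatation (A : ℂ →L[ℝ] ℂ) : ENNReal :=
  ENNReal.ofReal (‖(A 1 - Complex.I * A Complex.I) / 2‖ + ‖(A 1 + Complex.I * A Complex.I) / 2‖) /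
    ENNReal.ofReal
      (‖(A 1 - Complex.I * A Complex.I) / 2‖ - ‖(A 1 + Complex.I * A Complex.I) / 2‖)

/-- The quasiconformal distortion `K_g`: the supremum of the dilatation over all points where `g`
is (real) differentiable. Two lifts of `g` differ by a constant. -/
def distortion {Λ Λ' : Submodule ℤ ℂ} (g : Torus Λ → Torus Λ') : ENNReal :=
  ⨆ (F : ℂ → ℂ) (_ : IsLift g F) (z : ℂ) (_ : DifferentiableAt ℝ F z), dilatation (fderiv ℝ F z)

/-- `g` is smooth except at finitely many points. -/
def AlmostSmooth {Λ Λ' : Submodule ℤ ℂ} (g : Torus Λ → Torus Λ') : Prop :=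
  ∃ F : ℂ → ℂ, IsLift g F ∧ ∃ E : Set (Torus Λ), E.Finite ∧
    ∀ z : ℂ, proj Λ z ∉ E → ContDiffAt ℝ ∞ F z

/-- The Teichmüller distance `½ log inf K_g`, the infimum being over all homeomorphisms `g` in the
homotopy class of `f'⁻¹ ∘ f` that are smooth except at finitely many points,
as an extended real number. -/
def teichDist (m n : MarkedTorus) : EReal :=
  ((1 / 2 : ℝ) : EReal) * ENNReal.log
    (⨅ (g : Torus m.lattice ≃ₜ Torus n.lattice)
      (_ : m.RespectsMarkings n (g : C(_, _))) (_ : AlmostSmooth g), distortion g)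

/-- `ζ` is the modulus of the marked torus `m`: the basis `ω₁, ω₂` of the lattice that the marking
takes to `1, i` has quotient `ω₂ / ω₁ = ζ`. -/
def MarkedTorus.HasModulus (m : MarkedTorus) (ζ : ℂ) : Prop :=
  ∃ (F : ℂ → ℂ) (ω₁ ω₂ : ℂ), IsLift m.marking F ∧ ω₁ ∈ m.lattice ∧ ω₂ ∈ m.lattice ∧
    (∀ z, F (z + ω₁) = F z + 1) ∧ (∀ z, F (z + ω₂) = F z + Complex.I) ∧ ζ = ω₂ / ω₁

end FlatTorus

end

/-! A continuous map of tori lifts to `F : ℂ → ℂ`, and `F (z + l) - F z` lies in a discrete group,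
hence does not depend on `z`. So it equals `A l` for one real linear `A`. This `A` determines the
homotopy class (`homotopic_iff`), and `F - A` is periodic, hence bounded. The class of `f'⁻¹ ∘ f`
therefore contains exactly one linear map up to translation, `transition`, taking the marked periods
of one torus to those of the other. Orientation, given by winding numbers, makes its determinant
positive, so the moduli lie in `ℍ`. By Liouville a holomorphic map of tori has an affine lift, so
equivalence means proportional periods, that is, equal moduli.

Write the transition as `z ↦ a z + b z̄`. Its maximal stretch is `|a| + |b|` and its determinant is
`|a|² - |b|²`, so the area-normalized stretch squared and the dilatation are the same number `K =
(|a| + |b|) / (|a| - |b|)`. Solving for `a` and `b` from the periods gives `K = exp h(τ, σ)` for the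
two moduli (`stretch_sq`).

The linear map is optimal for both problems. A Lipschitz competitor has a lift within bounded
distance of `A`; comparing displacements along long segments bounds the stretch of `A`
(`HasPeriods.norm_le_of_lipschitz`). For a homeomorphism smooth off a finite set, the length-area
method does the same on average (`groetzsch`). Hence both functions equal `h / 2`, and the metric
axioms come from `ℍ`. -/

noncomputable section

namespace FlatTorus

open ComplexConjugate MeasureTheory Pointwise

variable {Λ Λ' Λ'' : Submodule ℤ ℂ}

/-! ### The covering `ℂ → ℂ / Λ` and lifts of maps -/

theorem proj_eq_proj {z w : ℂ} : proj Λ z = proj Λ w ↔ z - w ∈ Λ :=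
  Submodule.Quotient.eq Λ

theorem proj_add_of_mem {l : ℂ} (hl : l ∈ Λ) (z : ℂ) : proj Λ (z + l) = proj Λ z := by
  rw [proj_eq_proj]; simpa using hl

theorem proj_surjective (Λ : Submodule ℤ ℂ) : Function.Surjective (proj Λ) :=
  Submodule.Quotient.mk_surjective Λ

theorem isOpenQuotientMap_proj (Λ : Submodule ℤ ℂ) : IsOpenQuotientMap (proj Λ) :=
  Submodule.isOpenQuotientMap_mkQ Λ

theorem continuous_proj (Λ : Submodule ℤ ℂ) : Continuous (proj Λ) :=
  (isOpenQuotientMap_proj Λ).continuous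

theorem isCoveringMap_proj (Λ : Submodule ℤ ℂ) [DiscreteTopology Λ] :
    IsCoveringMap (proj Λ) :=
  ((isOpenQuotientMap_proj Λ).isQuotientMap.isAddQuotientCoveringMap_of_addSubgroup
    Λ.toAddSubgroup ⟨‹DiscreteTopology Λ›⟩ (by
      intro z w
      rw [proj_eq_proj, ← Λ.neg_mem_iff, neg_sub, sub_eq_add_neg]
      rfl)).isCoveringMap

/-- A continuous map with values in a discrete subgroup is constant. -/
theorem eq_of_mem_lattice [DiscreteTopology Λ] {X : Type*} [TopologicalSpace X]
    [PreconnectedSpace X] {f : X → ℂ} (hf : Continuous f) (hmem : ∀ x, f x ∈ Λ) (x y : X) :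
    f x = f y :=
  congrArg Subtype.val
    (PreconnectedSpace.constant ‹_› (f := fun x => (⟨f x, hmem x⟩ : Λ)) (by fun_prop) :
      (⟨f x, hmem x⟩ : Λ) = ⟨f y, hmem y⟩)

theorem exists_isLift [DiscreteTopology Λ'] {g : Torus Λ → Torus Λ'} (hg : Continuous g) :
    ∃ F, IsLift g F := by
  obtain ⟨w, hw⟩ := proj_surjective Λ' (g (proj Λ 0))
  obtain ⟨F, ⟨-, hF⟩, -⟩ := (isCoveringMap_proj Λ').existsUnique_continuousMap_lifts
    ⟨fun z => g (proj Λ z), hg.comp (continuous_proj Λ)⟩ 0 w hw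
  exact ⟨F, F.continuous, fun z => congrFun hF z⟩

theorem IsLift.comp {g : Torus Λ' → Torus Λ''} {f : Torus Λ → Torus Λ'} {G F : ℂ → ℂ}
    (hG : IsLift g G) (hF : IsLift f F) : IsLift (g ∘ f) (G ∘ F) :=
  ⟨hG.1.comp hF.1, fun z => by simp [hG.2, hF.2]⟩

theorem isLift_id (Λ : Submodule ℤ ℂ) : IsLift (id : Torus Λ → Torus Λ) id :=
  ⟨continuous_id, fun _ => rfl⟩

theorem IsLift.exists_eq_add [DiscreteTopology Λ'] {g : Torus Λ → Torus Λ'} {F G : ℂ → ℂ}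
    (hF : IsLift g F) (hG : IsLift g G) : ∃ c, ∀ z, G z = F z + c := by
  refine ⟨G 0 - F 0, fun z => ?_⟩
  have := eq_of_mem_lattice (Λ := Λ') (f := fun z => G z - F z) (hG.1.sub hF.1)
    (fun z => by rw [← proj_eq_proj, hF.2, hG.2]) z 0
  rw [sub_eq_iff_eq_add] at this
  rw [this]; ring

/-! ### Periods of lifts and homotopy classes -/

/-- The additive behaviour of `F` under translations by `Λ` is given by the real linear map `A`. -/
def HasPeriods (Λ : Submodule ℤ ℂ) (F : ℂ → ℂ) (A : ℂ →L[ℝ] ℂ) : Prop :=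
  ∀ l ∈ Λ, ∀ z, F (z + l) = F z + A l

/-- The increment `F (z + l) - F z` is continuous in `z` with values in `Λ'`, hence constant, and so
additive in `l`. A `ℤ`-basis of `Λ` is an `ℝ`-basis of `ℂ`, which gives the real linear extension.
-/
theorem IsLift.exists_hasPeriods [DiscreteTopology Λ] [IsZLattice ℝ Λ] [DiscreteTopology Λ']
    {g : Torus Λ → Torus Λ'} {F : ℂ → ℂ} (hF : IsLift g F) : ∃ A, HasPeriods Λ F A := by
  have key : ∀ l ∈ Λ, ∀ z, F (z + l) - F z = F l - F 0 := by
    intro l hl z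
    have := eq_of_mem_lattice (Λ := Λ') (f := fun z => F (z + l) - F z)
      ((hF.1.comp (continuous_id.add continuous_const)).sub hF.1)
      (fun z => by rw [← proj_eq_proj, hF.2, hF.2, proj_add_of_mem hl]) z 0
    simpa using this
  let ρ : Λ →+ ℂ := AddMonoidHom.mk' (fun l => F l - F 0) (by
    intro x y
    have := key y y.2 x
    simp only [Submodule.coe_add]
    linear_combination this)
  have := ZLattice.module_free ℝ Λ
  have := ZLattice.module_finite ℝ Λ
  let b := Module.Free.chooseBasis ℤ Λ
  let A : ℂ →ₗ[ℝ] ℂ := (b.ofZLatticeBasis ℝ Λ).constr ℝ (fun i => ρ (b i))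
  have hA : (A.restrictScalars ℤ).comp Λ.subtype = ρ.toIntLinearMap := by
    refine b.ext fun i => ?_
    have : A ((b.ofZLatticeBasis ℝ Λ) i) = ρ (b i) := Module.Basis.constr_basis _ _ _ _
    simpa using this
  refine ⟨LinearMap.toContinuousLinearMap A, fun l hl z => ?_⟩
  have h1 : A l = F l - F 0 := LinearMap.congr_fun hA ⟨l, hl⟩
  have h2 := key l hl z
  rw [LinearMap.coe_toContinuousLinearMap', h1, ← h2]; ring

theorem continuousLinearMap_ext_lattice (Λ : Submodule ℤ ℂ) [DiscreteTopology Λ] [IsZLattice ℝ Λ]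
    {A B : ℂ →L[ℝ] ℂ} (h : ∀ l ∈ Λ, A l = B l) : A = B := by
  have : (A : ℂ →ₗ[ℝ] ℂ) = B :=
    LinearMap.ext_on (IsZLattice.span_top (K := ℝ) (L := Λ)) (fun l hl => h l hl)
  exact ContinuousLinearMap.coe_injective this

theorem HasPeriods.unique [DiscreteTopology Λ] [IsZLattice ℝ Λ] {F : ℂ → ℂ} {A B : ℂ →L[ℝ] ℂ}
    (hA : HasPeriods Λ F A) (hB : HasPeriods Λ F B) : A = B :=
  continuousLinearMap_ext_lattice Λ fun l hl =>
    add_left_cancel ((hA l hl 0).symm.trans (hB l hl 0))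

theorem HasPeriods.add_const {F G : ℂ → ℂ} {A : ℂ →L[ℝ] ℂ} (hF : HasPeriods Λ F A) {c : ℂ}
    (h : ∀ z, G z = F z + c) : HasPeriods Λ G A := fun l hl z => by
  rw [h, h, hF l hl]; ring

theorem HasPeriods.of_isLift [DiscreteTopology Λ'] {g : Torus Λ → Torus Λ'}
    {F G : ℂ → ℂ} (hF : IsLift g F) (hG : IsLift g G) {A : ℂ →L[ℝ] ℂ} (h : HasPeriods Λ F A) :
    HasPeriods Λ G A := by
  obtain ⟨c, hc⟩ := hF.exists_eq_add hG
  exact h.add_const hc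

theorem HasPeriods.mem {g : Torus Λ → Torus Λ'} {F : ℂ → ℂ} {A : ℂ →L[ℝ] ℂ}
    (hF : IsLift g F) (h : HasPeriods Λ F A) {l : ℂ} (hl : l ∈ Λ) : A l ∈ Λ' := by
  have : A l = F (0 + l) - F 0 := by rw [h l hl]; ring
  rw [this, ← proj_eq_proj, hF.2, hF.2, proj_add_of_mem hl]

theorem HasPeriods.comp {g : Torus Λ → Torus Λ'} {G F : ℂ → ℂ} {B A : ℂ →L[ℝ] ℂ}
    (hF : IsLift g F) (hA : HasPeriods Λ F A) (hB : HasPeriods Λ' G B) :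
    HasPeriods Λ (G ∘ F) (B.comp A) := fun l hl z => by
  simp [hA l hl, hB _ (hA.mem hF hl)]

theorem hasPeriods_id (Λ : Submodule ℤ ℂ) : HasPeriods Λ id (ContinuousLinearMap.id ℝ ℂ) :=
  fun _ _ _ => rfl

theorem hasPeriods_linear (Λ : Submodule ℤ ℂ) (A : ℂ →L[ℝ] ℂ) : HasPeriods Λ A A :=
  fun _ _ _ => map_add A _ _

/-- `F - A` is periodic, so its range is compact. All later comparisons of a map with its linear
model rest on this bound. -/
theorem HasPeriods.exists_norm_sub_le [DiscreteTopology Λ] [IsZLattice ℝ Λ] {F : ℂ → ℂ}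
    {A : ℂ →L[ℝ] ℂ} (hF : Continuous F) (h : HasPeriods Λ F A) :
    ∃ C, ∀ z, ‖F z - A z‖ ≤ C := by
  have hc := IsZLattice.isCompact_range_of_periodic Λ (fun z => F z - A z)
    (hF.sub A.continuous) (fun z w hw => by rw [h w hw, map_add]; ring)
  obtain ⟨C, hC⟩ := hc.isBounded.exists_norm_le
  exact ⟨C, fun z => hC _ ⟨z, rfl⟩⟩

/-- Two continuous maps of tori are homotopic if and only if their lifts have the same periods. -/
theorem homotopic_iff [DiscreteTopology Λ] [IsZLattice ℝ Λ] [DiscreteTopology Λ']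
    {f₀ f₁ : C(Torus Λ, Torus Λ')} {F₀ F₁ : ℂ → ℂ} {A₀ A₁ : ℂ →L[ℝ] ℂ}
    (h₀ : IsLift f₀ F₀) (h₁ : IsLift f₁ F₁) (p₀ : HasPeriods Λ F₀ A₀) (p₁ : HasPeriods Λ F₁ A₁) :
    ContinuousMap.Homotopic f₀ f₁ ↔ A₀ = A₁ := by
  constructor
  · rintro ⟨H⟩
    let H' : C(unitInterval × ℂ, Torus Λ') :=
      H.toContinuousMap.comp ((ContinuousMap.id _).prodMap ⟨proj Λ, continuous_proj Λ⟩)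
    have hH0 : ∀ z, H' (0, z) = proj Λ' (F₀ z) := fun z => by
      rw [h₀.2]; exact H.apply_zero _
    let K := (isCoveringMap_proj Λ').liftHomotopy H' ⟨F₀, h₀.1⟩ hH0
    have hK : ∀ p, proj Λ' (K p) = H' p := fun p =>
      congrFun ((isCoveringMap_proj Λ').liftHomotopy_lifts H' ⟨F₀, h₀.1⟩ hH0) p
    have hK0 : ∀ z, K (0, z) = F₀ z :=
      (isCoveringMap_proj Λ').liftHomotopy_zero H' ⟨F₀, h₀.1⟩ hH0
    have hK1 : IsLift f₁ (fun z => K (1, z)) :=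
      ⟨by fun_prop, fun z => (hK (1, z)).trans (H.apply_one _)⟩
    -- The increment of the lifted homotopy under `l` takes values in `Λ'` on the connected space `I
    -- × ℂ`, so the periods at time `1` are those at time `0`.
    have hp : HasPeriods Λ (fun z => K (1, z)) A₀ := by
      intro l hl z
      have := eq_of_mem_lattice (Λ := Λ')
        (f := fun p : unitInterval × ℂ => K (p.1, p.2 + l) - K p) (by fun_prop)
        (fun p => by
          rw [← proj_eq_proj, hK, hK]
          exact congrArg (fun x => H (p.1, x)) (proj_add_of_mem hl p.2)) (1, z) (0, z)
      simp only [hK0, p₀ l hl] at this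
      linear_combination this
    exact hp.unique (p₁.of_isLift h₁ hK1)
  · rintro rfl
    have hq := IsOpenQuotientMap.id (X := unitInterval).prodMap (isOpenQuotientMap_proj Λ)
    -- The straight-line homotopy of the lifts: equal periods make `F₁ - F₀` periodic, so it
    -- descends to the torus.
    let S : unitInterval × ℂ → Torus Λ' := fun p => proj Λ' (F₀ p.2 + (p.1 : ℝ) * (F₁ p.2 - F₀ p.2))
    have hS : Continuous S := by
      have := h₀.1
      have := h₁.1
      exact (continuous_proj Λ').comp (by fun_prop)
    have hSq : ∀ t z w, proj Λ z = proj Λ w → S (t, z) = S (t, w) := by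
      intro t z w h
      rw [proj_eq_proj] at h
      have e : z = w + (z - w) := by ring
      simp only [S]
      rw [e, p₀ _ h, p₁ _ h, proj_eq_proj]
      convert p₀.mem h₀ h using 1
      ring
    let q : C(unitInterval × ℂ, unitInterval × Torus Λ) := ⟨Prod.map id (proj Λ), hq.continuous⟩
    have hq' : Topology.IsQuotientMap q := hq.isQuotientMap
    have hfac : Function.FactorsThrough (⟨S, hS⟩ : C(_, Torus Λ')) q := by
      rintro ⟨t, z⟩ ⟨s, w⟩ h
      obtain rfl : t = s := congrArg Prod.fst h
      exact hSq _ _ _ (congrArg Prod.snd h)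
    let H : C(unitInterval × Torus Λ, Torus Λ') := hq'.lift ⟨S, hS⟩ hfac
    have hH : ∀ t z, H (t, proj Λ z) = S (t, z) := fun t z =>
      congrFun (congrArg DFunLike.coe (hq'.lift_comp ⟨S, hS⟩ hfac)) (t, z)
    refine ⟨⟨H, fun x => ?_, fun x => ?_⟩⟩
    · obtain ⟨z, rfl⟩ := proj_surjective Λ x
      change H (0, proj Λ z) = _
      rw [hH, ← h₀.2]; simp [S]
    · obtain ⟨z, rfl⟩ := proj_surjective Λ x
      change H (1, proj Λ z) = _
      rw [hH, ← h₁.2]; simp [S]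

/-- The lift of a homeomorphism of tori has invertible periods. -/
theorem exists_hasPeriods_homeomorph [DiscreteTopology Λ] [IsZLattice ℝ Λ] [DiscreteTopology Λ']
    [IsZLattice ℝ Λ'] (g : Torus Λ ≃ₜ Torus Λ') {F : ℂ → ℂ} (hF : IsLift g F) :
    ∃ A : ℂ ≃L[ℝ] ℂ, HasPeriods Λ F A ∧ ∀ l, A l ∈ Λ' ↔ l ∈ Λ := by
  obtain ⟨G, hG⟩ := exists_isLift (Λ' := Λ) g.symm.continuous
  obtain ⟨A, hA⟩ := hF.exists_hasPeriods
  obtain ⟨B, hB⟩ := hG.exists_hasPeriods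
  have h1 : B.comp A = ContinuousLinearMap.id ℝ ℂ :=
    (hA.comp hF hB).unique ((hasPeriods_id Λ).of_isLift (isLift_id Λ)
      (by simpa using hG.comp hF))
  have h2 : A.comp B = ContinuousLinearMap.id ℝ ℂ :=
    (hB.comp hG hA).unique ((hasPeriods_id Λ').of_isLift (isLift_id Λ')
      (by simpa using hF.comp hG))
  refine ⟨ContinuousLinearEquiv.equivOfInverse A B (fun z => congrArg (· z) h1)
    (fun z => congrArg (· z) h2), hA, fun l => ⟨fun h => ?_, fun h => hA.mem hF h⟩⟩
  have h3 : B (A l) ∈ Λ := hB.mem hG h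
  rwa [show B (A l) = l from congrArg (· l) h1] at h3

/-- The homeomorphism of tori induced by a real linear isomorphism that maps `Λ` onto `Λ'`. -/
def linearHomeomorph (A : ℂ ≃L[ℝ] ℂ) (h : ∀ l, A l ∈ Λ' ↔ l ∈ Λ) : Torus Λ ≃ₜ Torus Λ' where
  toEquiv := (Submodule.Quotient.equiv Λ Λ' (A.toLinearEquiv.restrictScalars ℤ) (by
    ext z
    simp only [Submodule.mem_map]
    constructor
    · rintro ⟨y, hy, rfl⟩; exact (h y).2 hy
    · intro hz
      exact ⟨A.symm z, (h _).1 (by simpa using hz), A.apply_symm_apply z⟩)).toEquiv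
  continuous_toFun := (isOpenQuotientMap_proj Λ).isQuotientMap.continuous_iff.2
    ((continuous_proj Λ').comp A.continuous)
  continuous_invFun := (isOpenQuotientMap_proj Λ').isQuotientMap.continuous_iff.2
    ((continuous_proj Λ).comp A.symm.continuous)

theorem isLift_linearHomeomorph (A : ℂ ≃L[ℝ] ℂ) (h : ∀ l, A l ∈ Λ' ↔ l ∈ Λ) :
    IsLift (linearHomeomorph A h) A := ⟨A.continuous, fun _ => rfl⟩

theorem isLift_linearHomeomorph_symm (A : ℂ ≃L[ℝ] ℂ) (h : ∀ l, A l ∈ Λ' ↔ l ∈ Λ) :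
    IsLift (linearHomeomorph A h).symm A.symm := ⟨A.symm.continuous, fun _ => rfl⟩

/-! ### Real linear maps of the plane -/

/-- The coefficient of `dz` in a real linear map. -/
def dzPart (A : ℂ →L[ℝ] ℂ) : ℂ := (A 1 - Complex.I * A Complex.I) / 2

/-- The coefficient of `dz̄` in a real linear map. -/
def dzbarPart (A : ℂ →L[ℝ] ℂ) : ℂ := (A 1 + Complex.I * A Complex.I) / 2

theorem clm_apply_eq_re_im (A : ℂ →L[ℝ] ℂ) (z : ℂ) : A z = z.re * A 1 + z.im * A Complex.I := by
  have h : z = z.re • (1 : ℂ) + z.im • Complex.I := by simp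
  conv_lhs => rw [h, map_add, map_smul, map_smul]
  simp

theorem clm_apply_eq (A : ℂ →L[ℝ] ℂ) (z : ℂ) : A z = dzPart A * z + dzbarPart A * conj z := by
  rw [clm_apply_eq_re_im, dzPart, dzbarPart]
  conv_rhs => rw [← Complex.re_add_im z]
  simp only [map_add, map_mul, Complex.conj_ofReal, Complex.conj_I]
  linear_combination ((z.im : ℂ) * A Complex.I) * Complex.I_sq

theorem norm_clm_apply_le (A : ℂ →L[ℝ] ℂ) (z : ℂ) :
    ‖A z‖ ≤ (‖dzPart A‖ + ‖dzbarPart A‖) * ‖z‖ := by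
  rw [clm_apply_eq]
  refine (norm_add_le _ _).trans_eq ?_
  rw [norm_mul, norm_mul, RCLike.norm_conj]; ring

theorem exists_norm_clm_apply_eq (A : ℂ →L[ℝ] ℂ) :
    ∃ v : ℂ, ‖v‖ = 1 ∧ ‖A v‖ = ‖dzPart A‖ + ‖dzbarPart A‖ := by
  set a := dzPart A with ha
  set b := dzbarPart A with hb
  -- This direction gives `a v` and `b v̄` the common argument `(arg a + arg b) / 2`, so their norms
  -- add.
  set s : ℝ := (b.arg - a.arg) / 2 with hs
  refine ⟨Complex.exp (s * Complex.I), Complex.norm_exp_ofReal_mul_I s, ?_⟩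
  have h : A (Complex.exp (s * Complex.I)) =
      ((‖a‖ + ‖b‖ : ℝ) : ℂ) * Complex.exp (((b.arg + a.arg) / 2 : ℝ) * Complex.I) := by
    rw [clm_apply_eq, ← ha, ← hb, ← Complex.exp_conj]
    conv_lhs => rw [← Complex.norm_mul_exp_arg_mul_I a, ← Complex.norm_mul_exp_arg_mul_I b]
    rw [mul_assoc, mul_assoc, ← Complex.exp_add, ← Complex.exp_add, Complex.ofReal_add, add_mul]
    congr 3
    · rw [hs]; push_cast; ring
    · rw [hs, map_mul, Complex.conj_ofReal, Complex.conj_I]; push_cast; ring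
  rw [h, norm_mul, Complex.norm_exp_ofReal_mul_I, mul_one, Complex.norm_real, Real.norm_eq_abs,
    abs_of_nonneg (by positivity)]

theorem det_clm_eq (A : ℂ →L[ℝ] ℂ) : A.det = ‖dzPart A‖ ^ 2 - ‖dzbarPart A‖ ^ 2 := by
  have h : A.det = (A 1).re * (A Complex.I).im - (A Complex.I).re * (A 1).im := by
    rw [ContinuousLinearMap.det, ← LinearMap.det_toMatrix Complex.basisOneI, Matrix.det_fin_two]
    simp [LinearMap.toMatrix_apply]
  rw [h, Complex.sq_norm, Complex.sq_norm, Complex.normSq_apply, Complex.normSq_apply,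
    dzPart, dzbarPart]
  simp
  ring

/-- `Im (z̄ w)` is the signed area of the parallelogram on `z` and `w`, which the determinant
scales. -/
theorem im_conj_mul_clm_apply (A : ℂ →L[ℝ] ℂ) (z w : ℂ) :
    (conj (A z) * A w).im = A.det * (conj z * w).im := by
  rw [det_clm_eq, clm_apply_eq, clm_apply_eq, Complex.sq_norm, Complex.sq_norm,
    Complex.normSq_apply, Complex.normSq_apply]
  simp
  ring

/-! ### Orientation and winding numbers -/

/-- A circle around `0` is mapped to a loop of winding number `1` by
an orientation preserving real linear map. -/
theorem windsOnce_linear {A : ℂ →L[ℝ] ℂ} (hA : 0 < A.det) {r : ℝ} (hr : 0 < r) :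
    WindsOnce fun t : ℝ => A (r * Complex.exp (t * Complex.I)) := by
  rw [det_clm_eq, sub_pos] at hA
  set a := dzPart A with ha
  set b := dzbarPart A with hb
  have hab : ‖b‖ < ‖a‖ := lt_of_pow_lt_pow_left₀ 2 (norm_nonneg _) hA
  have ha0 : a ≠ 0 := norm_pos_iff.1 ((norm_nonneg _).trans_lt hab)
  -- Factoring `r a exp(it)` out of the loop leaves `u`. Since `|b| < |a|`, it stays in the right
  -- half-plane, where the principal argument is continuous.
  let u : ℝ → ℂ := fun t => 1 + b / a * Complex.exp ((-2 * t : ℝ) * Complex.I)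
  have hu : Continuous u := by fun_prop
  have hre : ∀ t, 0 < (u t).re := by
    intro t
    have h1 : ‖b / a * Complex.exp ((-2 * t : ℝ) * Complex.I)‖ < 1 := by
      rw [norm_mul, Complex.norm_exp_ofReal_mul_I, mul_one, norm_div,
        div_lt_one (norm_pos_iff.2 ha0)]
      exact hab
    have h2 := (abs_le.1 (Complex.abs_re_le_norm
      (b / a * Complex.exp ((-2 * t : ℝ) * Complex.I)))).1
    simp only [u, Complex.add_re, Complex.one_re]
    linarith
  have hγ : ∀ t : ℝ, A (r * Complex.exp (t * Complex.I)) =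
      r * Complex.exp (t * Complex.I) * a * u t := by
    intro t
    have h1 : Complex.exp ((-2 * t : ℝ) * Complex.I) * Complex.exp (t * Complex.I) =
        conj (Complex.exp (t * Complex.I)) := by
      rw [← Complex.exp_conj, ← Complex.exp_add]
      congr 1
      simp
      ring
    rw [clm_apply_eq, ← ha, ← hb, map_mul, Complex.conj_ofReal, ← h1]
    simp only [u]
    field_simp
  have hu0 : ∀ t, u t ≠ 0 := fun t h => by simpa [h] using hre t
  have hne : ∀ t : ℝ, A (r * Complex.exp (t * Complex.I)) ≠ 0 := by
    intro t
    rw [hγ]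
    exact mul_ne_zero (mul_ne_zero (mul_ne_zero (by exact_mod_cast hr.ne') (Complex.exp_ne_zero _))
      ha0) (hu0 t)
  refine ⟨hne, fun t => t + a.arg + (u t).arg, ?_, fun t => ?_, ?_⟩
  · refine (continuous_id.add continuous_const).add ?_
    exact continuous_iff_continuousAt.2 fun t =>
      (Complex.continuousAt_arg (Or.inl (hre t))).comp hu.continuousAt
  · simp only [hγ]
    have e : Complex.exp (((t + a.arg + (u t).arg : ℝ) : ℂ) * Complex.I) =
        Complex.exp (t * Complex.I) * Complex.exp (a.arg * Complex.I) *
          Complex.exp ((u t).arg * Complex.I) := by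
      rw [← Complex.exp_add, ← Complex.exp_add]; congr 1; push_cast; ring
    rw [e, norm_mul, norm_mul, norm_mul, Complex.norm_exp_ofReal_mul_I, Complex.norm_real,
      Real.norm_eq_abs, abs_of_pos hr]
    conv_lhs => rw [← Complex.norm_mul_exp_arg_mul_I a, ← Complex.norm_mul_exp_arg_mul_I (u t)]
    push_cast
    ring
  · have : u (2 * Real.pi) = u 0 := by
      simp only [u]
      congr 2
      rw [Complex.exp_eq_exp_iff_exists_int]
      exact ⟨-2, by push_cast; ring⟩
    simp only [this]; ring

/-- The real linear map that describes the periods of an orientation preserving homeomorphism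
cannot reverse the orientation. -/
theorem norm_dzbarPart_le_of_windsOnce {F : ℂ → ℂ} (hF : Continuous F) {A : ℂ →L[ℝ] ℂ} {C : ℝ}
    (hC : ∀ z, ‖F z - A z‖ ≤ C)
    (hw : ∀ r : ℝ, 0 < r → WindsOnce fun t : ℝ => F (0 + r * Complex.exp (t * Complex.I)) - F 0) :
    ‖dzbarPart A‖ ≤ ‖dzPart A‖ := by
  by_contra! hab
  set a := dzPart A with ha
  set b := dzbarPart A with hb
  have hb0 : b ≠ 0 := norm_pos_iff.1 ((norm_nonneg _).trans_lt hab)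
  have hC0 : 0 ≤ C := (norm_nonneg _).trans (hC 0)
  -- On a circle this large the term `b z̄` dominates both `a z` and the error, at most `2 * C`, of
  -- replacing `F` by `A`. The loop then runs like `exp(-it)`, and `u` below stays within distance
  -- `1` of `1`.
  obtain ⟨r, hr⟩ : ∃ r : ℝ, r = (2 * C + 1) / (‖b‖ - ‖a‖) := ⟨_, rfl⟩
  have hr0 : 0 < r := hr ▸ div_pos (by linarith) (by linarith)
  have hr1 : r * ‖a‖ + 2 * C < r * ‖b‖ := by
    have : r * (‖b‖ - ‖a‖) = 2 * C + 1 := by rw [hr]; field_simp [(sub_pos.2 hab).ne']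
    linarith
  obtain ⟨-, θ, hθ, hθγ, hθ1⟩ := hw r hr0
  simp only [zero_add] at hθγ
  set γ : ℝ → ℂ := fun t => F (r * Complex.exp (t * Complex.I)) - F 0 with hγ
  have hγc : Continuous γ := by fun_prop
  let u : ℝ → ℂ := fun t => γ t * Complex.exp (t * Complex.I) / (r * b)
  have huc : Continuous u := by
    simp only [u]; fun_prop
  have hrb : (r * b : ℂ) ≠ 0 := mul_ne_zero (by exact_mod_cast hr0.ne') hb0
  have hre : ∀ t, 0 < (u t).re := by
    intro t
    have h1 : ‖u t - 1‖ < 1 := by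
      have e : u t - 1 = (r * a * Complex.exp (t * Complex.I) ^ 2 +
          ((F (r * Complex.exp (t * Complex.I)) - A (r * Complex.exp (t * Complex.I))) - 
            (F 0 - A 0)) * Complex.exp (t * Complex.I)) / (r * b) := by
        have h1 : Complex.exp (t * Complex.I) * conj (Complex.exp (t * Complex.I)) = 1 := by
          rw [Complex.mul_conj, Complex.normSq_eq_norm_sq, Complex.norm_exp_ofReal_mul_I]; simp
        rw [eq_div_iff hrb, sub_mul, div_mul_cancel₀ _ hrb, map_zero, clm_apply_eq A, ← ha, ← hb,
          map_mul, Complex.conj_ofReal]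
        simp only [hγ]
        linear_combination (r * b) * h1
      rw [e, norm_div, div_lt_one (norm_pos_iff.2 hrb), norm_mul, Complex.norm_real,
        Real.norm_eq_abs, abs_of_pos hr0]
      refine lt_of_le_of_lt (norm_add_le _ _) (lt_of_le_of_lt ?_ hr1)
      rw [norm_mul, norm_mul, norm_mul, norm_pow, Complex.norm_exp_ofReal_mul_I, Complex.norm_real,
        Real.norm_eq_abs, abs_of_pos hr0]
      have := (norm_sub_le _ _).trans (add_le_add (hC (r * Complex.exp (t * Complex.I))) (hC 0))
      linarith
    have h2 := (abs_le.1 (Complex.abs_re_le_norm (u t - 1))).1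
    rw [Complex.sub_re, Complex.one_re] at h2
    linarith
  -- `ψ` is continuous with values in `2πℤ`, hence constant. But `u` is periodic, so `θ t + t` would
  -- force `ψ` to grow by `4π` over one turn.
  let ψ : ℝ → ℝ := fun t => θ t + t - b.arg - (u t).arg
  have hψc : Continuous ψ := by
    refine ((hθ.add continuous_id).sub continuous_const).sub ?_
    exact continuous_iff_continuousAt.2 fun t =>
      (Complex.continuousAt_arg (Or.inl (hre t))).comp huc.continuousAt
  have hψ : ∀ t, ∃ n : ℤ, ψ t = n * (2 * Real.pi) := by
    intro t
    have hu0 : u t ≠ 0 := fun h => by simpa [h] using hre t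
    have h1 : u t * (r * b) = γ t * Complex.exp (t * Complex.I) := div_mul_cancel₀ _ hrb
    have h2 : ‖u t‖ * (r * ‖b‖) = ‖γ t‖ := by
      have := congrArg norm h1
      rwa [norm_mul, norm_mul, norm_mul, Complex.norm_exp_ofReal_mul_I, Complex.norm_real,
        Real.norm_eq_abs, abs_of_pos hr0, mul_one] at this
    have h3 : Complex.exp (ψ t * Complex.I) = 1 := by
      have h4 : Complex.exp (θ t * Complex.I) * Complex.exp (t * Complex.I) =
          Complex.exp ((u t).arg * Complex.I) * Complex.exp (b.arg * Complex.I) := by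
        have h5 : (‖γ t‖ : ℂ) ≠ 0 := by
          rw [← h2]
          exact_mod_cast mul_ne_zero (norm_ne_zero_iff.2 hu0)
            (mul_ne_zero hr0.ne' (norm_ne_zero_iff.2 hb0))
        apply mul_left_cancel₀ h5
        rw [← mul_assoc, ← hθγ t, ← h1, ← h2]
        conv_lhs => rw [← Complex.norm_mul_exp_arg_mul_I (u t), ← Complex.norm_mul_exp_arg_mul_I b]
        push_cast
        ring
      have h6 : (ψ t * Complex.I : ℂ) = (θ t * Complex.I + t * Complex.I) -
          ((u t).arg * Complex.I + b.arg * Complex.I) := by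
        simp only [ψ]; push_cast; ring
      rw [h6, Complex.exp_sub, Complex.exp_add, Complex.exp_add, h4, div_self]
      exact mul_ne_zero (Complex.exp_ne_zero _) (Complex.exp_ne_zero _)
    obtain ⟨n, hn⟩ := Complex.exp_eq_one_iff.1 h3
    refine ⟨n, ?_⟩
    have h7 : (ψ t : ℂ) = n * (2 * Real.pi) :=
      mul_right_cancel₀ Complex.I_ne_zero (by rw [hn]; ring)
    exact_mod_cast h7
  choose n hn using hψ
  have hpi := Real.pi_pos
  have hnc : Continuous n := by
    rw [Int.isClosedEmbedding_coe_real.isInducing.continuous_iff]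
    have : ((↑) : ℤ → ℝ) ∘ n = fun t => ψ t / (2 * Real.pi) := by
      funext t
      simp only [Function.comp, hn]
      field_simp
    rw [this]; fun_prop
  have hconst : n (2 * Real.pi) = n 0 := PreconnectedSpace.constant inferInstance hnc
  have hper : u (2 * Real.pi) = u 0 := by
    simp [u, hγ, Complex.exp_two_pi_mul_I]
  have h8 := hn (2 * Real.pi)
  have h9 := hn 0
  rw [hconst, ← h9] at h8
  simp only [ψ, hper, hθ1] at h8
  linarith

-- Marked periods, the modulus and the transition map

attribute [instance] MarkedTorus.discrete MarkedTorus.isZLattice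

theorem gaussianLattice_eq_span_range :
    gaussianLattice = Submodule.span ℤ (Set.range Complex.basisOneI) := by
  rw [gaussianLattice, Complex.coe_basisOneI]
  congr 1
  simp [Matrix.range_cons, Set.pair_comm]

instance : DiscreteTopology gaussianLattice := by
  rw [gaussianLattice_eq_span_range]; infer_instance

instance : IsZLattice ℝ gaussianLattice :=
  ⟨by rw [gaussianLattice_eq_span_range, ZSpan.span_top]⟩

theorem one_mem_gaussianLattice : (1 : ℂ) ∈ gaussianLattice :=
  Submodule.subset_span (by simp)

theorem I_mem_gaussianLattice : Complex.I ∈ gaussianLattice :=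
  Submodule.subset_span (by simp)

/-- Scaling a lattice by a real linear map scales the covolume by the determinant. -/
theorem covolume_eq_det_mul [DiscreteTopology Λ] [IsZLattice ℝ Λ] [DiscreteTopology Λ']
    [IsZLattice ℝ Λ'] (A : ℂ ≃L[ℝ] ℂ) (h : ∀ w, A w ∈ Λ' ↔ w ∈ Λ) :
    ZLattice.covolume Λ' = |(A : ℂ →L[ℝ] ℂ).det| * ZLattice.covolume Λ := by
  have := ZLattice.module_free ℝ Λ
  have := ZLattice.module_finite ℝ Λ
  let b := Module.Free.chooseBasis ℤ Λ
  let e : Λ ≃ₗ[ℤ] Λ' :=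
    { toFun := fun x => ⟨A x, (h x).2 x.2⟩
      map_add' := fun x y => Subtype.ext (map_add A _ _)
      map_smul' := fun n x => Subtype.ext (map_zsmul A _ _)
      invFun := fun y => ⟨A.symm y, (h _).1 (by simp)⟩
      left_inv := fun x => Subtype.ext (A.symm_apply_apply _)
      right_inv := fun x => Subtype.ext (A.apply_symm_apply _) }
  rw [ZLattice.covolume_eq_measure_fundamentalDomain Λ' _
      (ZLattice.isAddFundamentalDomain (b.map e) MeasureTheory.volume),
    ZLattice.covolume_eq_measure_fundamentalDomain Λ _
      (ZLattice.isAddFundamentalDomain b MeasureTheory.volume)]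
  have hb : (b.map e).ofZLatticeBasis ℝ Λ' = (b.ofZLatticeBasis ℝ Λ).map A.toLinearEquiv := by
    ext i
    simp [e]
  rw [hb, ← ZSpan.map_fundamentalDomain, MeasureTheory.measureReal_def,
    MeasureTheory.measureReal_def]
  have := MeasureTheory.Measure.addHaar_image_continuousLinearMap (MeasureTheory.volume)
    (A : ℂ →L[ℝ] ℂ) (ZSpan.fundamentalDomain (b.ofZLatticeBasis ℝ Λ))
  erw [this]
  rw [ENNReal.toReal_mul, ENNReal.toReal_ofReal (abs_nonneg _)]

namespace MarkedTorus

theorem exists_periodMap (m : MarkedTorus) : ∃ A : ℂ ≃L[ℝ] ℂ,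
    (∃ F, IsLift m.marking F ∧ HasPeriods m.lattice F A) ∧
      (∀ w, A w ∈ gaussianLattice ↔ w ∈ m.lattice) ∧ 0 < (A : ℂ →L[ℝ] ℂ).det := by
  obtain ⟨F, hF, hw⟩ := m.orientation
  obtain ⟨A, hA, hmem⟩ := exists_hasPeriods_homeomorph m.marking hF
  refine ⟨A, ⟨F, hF, hA⟩, hmem, ?_⟩
  obtain ⟨C, hC⟩ := hA.exists_norm_sub_le hF.1
  have hle := norm_dzbarPart_le_of_windsOnce hF.1 hC (hw 0)
  -- Winding numbers give only a nonnegative determinant; invertibility of the period map excludes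
  -- zero.
  refine lt_of_le_of_ne ?_ (LinearEquiv.isUnit_det' A.toLinearEquiv).ne_zero.symm
  rw [det_clm_eq, sub_nonneg]
  gcongr

/-- The real linear isomorphism that describes how the lifts of the marking transform
under translations by the lattice. -/
def periodMap (m : MarkedTorus) : ℂ ≃L[ℝ] ℂ := m.exists_periodMap.choose

variable (m n : MarkedTorus)

theorem periodMap_mem {w : ℂ} : m.periodMap w ∈ gaussianLattice ↔ w ∈ m.lattice :=
  m.exists_periodMap.choose_spec.2.1 w

theorem periodMap_det_pos : 0 < (m.periodMap : ℂ →L[ℝ] ℂ).det :=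
  m.exists_periodMap.choose_spec.2.2

theorem exists_isLift_hasPeriods :
    ∃ F, IsLift m.marking F ∧ HasPeriods m.lattice F m.periodMap :=
  m.exists_periodMap.choose_spec.1

theorem eq_periodMap {F : ℂ → ℂ} {A : ℂ →L[ℝ] ℂ} (hF : IsLift m.marking F)
    (hA : HasPeriods m.lattice F A) : A = m.periodMap := by
  obtain ⟨G, hG, hGp⟩ := m.exists_isLift_hasPeriods
  exact hA.unique (hGp.of_isLift hG hF)

/-- The period that the marking takes to `1`. -/
def period₁ : ℂ := m.periodMap.symm 1

/-- The period that the marking takes to `i`. -/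
def period₂ : ℂ := m.periodMap.symm Complex.I

@[simp] theorem periodMap_period₁ : m.periodMap m.period₁ = 1 := m.periodMap.apply_symm_apply 1

@[simp] theorem periodMap_period₂ : m.periodMap m.period₂ = Complex.I :=
  m.periodMap.apply_symm_apply _

theorem period₁_ne_zero : m.period₁ ≠ 0 := fun h => by
  have := m.periodMap_period₁
  rw [h, map_zero] at this
  exact zero_ne_one this

theorem det_mul_im_conj_mul :
    (m.periodMap : ℂ →L[ℝ] ℂ).det * (conj m.period₁ * m.period₂).im = 1 := by
  rw [← im_conj_mul_clm_apply]
  simp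

theorem im_conj_mul_pos : 0 < (conj m.period₁ * m.period₂).im :=
  pos_of_mul_pos_right (m.det_mul_im_conj_mul ▸ one_pos) m.periodMap_det_pos.le

theorem im_conj_mul_eq :
    (conj m.period₁ * m.period₂).im = ‖m.period₁‖ ^ 2 * (m.period₂ / m.period₁).im := by
  have h := m.period₁_ne_zero
  have : conj m.period₁ * m.period₂ = ((‖m.period₁‖ ^ 2 : ℝ) : ℂ) * (m.period₂ / m.period₁) := by
    rw [← Complex.normSq_eq_norm_sq, ← Complex.mul_conj]
    field_simp
  rw [this, Complex.im_ofReal_mul]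

theorem im_div_pos : 0 < (m.period₂ / m.period₁).im := by
  have h := m.im_conj_mul_pos
  rw [im_conj_mul_eq] at h
  exact pos_of_mul_pos_right h (by positivity)

/-- The modulus `ω₂ / ω₁` of a marked torus. -/
def modulus : ℍ := ⟨m.period₂ / m.period₁, m.im_div_pos⟩

theorem coe_modulus : (m.modulus : ℂ) = m.period₂ / m.period₁ := rfl

theorem period₂_eq : m.period₂ = m.modulus * m.period₁ := by
  rw [coe_modulus, div_mul_cancel₀ _ m.period₁_ne_zero]

theorem hasModulus_modulus : m.HasModulus m.modulus := by
  obtain ⟨F, hF, hp⟩ := m.exists_isLift_hasPeriods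
  have h1 : m.period₁ ∈ m.lattice := by
    rw [← periodMap_mem, periodMap_period₁]; exact one_mem_gaussianLattice
  have h2 : m.period₂ ∈ m.lattice := by
    rw [← periodMap_mem, periodMap_period₂]; exact I_mem_gaussianLattice
  exact ⟨F, m.period₁, m.period₂, hF, h1, h2, fun z => by simp [hp _ h1],
    fun z => by simp [hp _ h2], rfl⟩

/-- The real linear isomorphism that takes the distinguished periods of `m` to those of `n`. -/
def transition : ℂ ≃L[ℝ] ℂ := m.periodMap.trans n.periodMap.symm

theorem transition_mem (w : ℂ) : m.transition n w ∈ n.lattice ↔ w ∈ m.lattice := by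
  rw [← periodMap_mem, ← periodMap_mem]
  simp [transition]

@[simp] theorem transition_period₁ : m.transition n m.period₁ = n.period₁ := by
  simp [transition, period₁]

@[simp] theorem transition_period₂ : m.transition n m.period₂ = n.period₂ := by
  simp [transition, period₂]

theorem det_transition_mul_im : ((m.transition n : ℂ →L[ℝ] ℂ)).det *
    (conj m.period₁ * m.period₂).im = (conj n.period₁ * n.period₂).im := by
  rw [← im_conj_mul_clm_apply]
  simp

theorem det_transition_pos : 0 < (m.transition n : ℂ →L[ℝ] ℂ).det := by
  have h := n.im_conj_mul_pos
  rw [← m.det_transition_mul_im n] at h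
  exact pos_of_mul_pos_left h m.im_conj_mul_pos.le

theorem clm_ext_periods {A B : ℂ →L[ℝ] ℂ} (h1 : A m.period₁ = B m.period₁)
    (h2 : A m.period₂ = B m.period₂) : A = B := by
  have : A.comp (m.periodMap.symm : ℂ →L[ℝ] ℂ) = B.comp (m.periodMap.symm : ℂ →L[ℝ] ℂ) := by
    ext z
    rw [clm_apply_eq_re_im, clm_apply_eq_re_im (B.comp _)]
    exact congrArg₂ (fun u v => (z.re : ℂ) * u + z.im * v) h1 h2
  ext z
  simpa using congrArg (fun T : ℂ →L[ℝ] ℂ => T (m.periodMap z)) this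

theorem exists_isLift_changeOfMarking :
    ∃ F, IsLift (m.changeOfMarking n) F ∧ HasPeriods m.lattice F (m.transition n) := by
  obtain ⟨F, hF, hFp⟩ := m.exists_isLift_hasPeriods
  obtain ⟨G, hG⟩ := exists_isLift (Λ' := n.lattice) n.marking.symm.continuous
  obtain ⟨B, hB⟩ := hG.exists_hasPeriods
  obtain ⟨K, hK, hKp⟩ := n.exists_isLift_hasPeriods
  have h1 : B.comp (n.periodMap : ℂ →L[ℝ] ℂ) = ContinuousLinearMap.id ℝ ℂ :=
    (hKp.comp hK hB).unique ((hasPeriods_id n.lattice).of_isLift (isLift_id n.lattice)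
      (by simpa using hG.comp hK))
  have h2 : B = (n.periodMap.symm : ℂ →L[ℝ] ℂ) := by
    ext z
    simpa using congrArg (fun T : ℂ →L[ℝ] ℂ => T (n.periodMap.symm z)) h1
  refine ⟨G ∘ F, hG.comp hF, ?_⟩
  have := hFp.comp hF hB
  rw [h2] at this
  exact this

theorem respectsMarkings_iff {φ : C(Torus m.lattice, Torus n.lattice)} {F : ℂ → ℂ}
    {A : ℂ →L[ℝ] ℂ} (hF : IsLift φ F) (hA : HasPeriods m.lattice F A) :
    m.RespectsMarkings n φ ↔ A = m.transition n := by
  obtain ⟨G, hG, hGp⟩ := m.exists_isLift_changeOfMarking n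
  exact homotopic_iff hF (f₁ := (m.changeOfMarking n : C(_, _))) hG hA hGp

/-- The linear homeomorphism in the homotopy class determined by the markings. -/
def linearMap : Torus m.lattice ≃ₜ Torus n.lattice :=
  linearHomeomorph (m.transition n) (m.transition_mem n)

theorem isLift_linearMap : IsLift (m.linearMap n) (m.transition n) :=
  isLift_linearHomeomorph _ _

theorem respectsMarkings_linearMap : m.RespectsMarkings n (m.linearMap n : C(_, _)) :=
  (m.respectsMarkings_iff n (φ := (m.linearMap n : C(_, _))) (m.isLift_linearMap n)
    (hasPeriods_linear _ (m.transition n : ℂ →L[ℝ] ℂ))).2 rfl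

/-! ### The modulus classifies marked tori -/

variable {m n}

/-- The derivative of a holomorphic lift is entire and periodic, hence bounded, hence constant by
Liouville. Both marked periods are thus multiplied by the same complex number, and their quotient is
unchanged. -/
theorem modulus_eq_of_equivalent (h : m.Equivalent n) : m.modulus = n.modulus := by
  obtain ⟨h, ⟨H, hH, hl⟩, -, hhom⟩ := h
  obtain ⟨A, hA⟩ := hl.exists_hasPeriods
  have hper : ∀ z, ∀ w ∈ m.lattice, deriv H (z + w) = deriv H z := by
    intro z w hw
    rw [← deriv_comp_add_const]
    have : (fun x => H (x + w)) = fun x => H x + A w := funext fun x => hA w hw x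
    rw [this, deriv_add_const]
  have hdc : Differentiable ℂ (deriv H) := hH.deriv
  have hb := (IsZLattice.isCompact_range_of_periodic m.lattice (deriv H) hdc.continuous
    hper).isBounded
  have hconst : ∀ z, deriv H z = deriv H 0 := fun z => hdc.apply_eq_apply_of_bounded hb z 0
  have hlin : ∀ z, H z = deriv H 0 * z + H 0 := by
    have h1 : Differentiable ℂ fun z => H z - deriv H 0 * z := by fun_prop
    have h2 : ∀ z, deriv (fun z => H z - deriv H 0 * z) z = 0 := by
      intro z
      rw [deriv_fun_sub hH.differentiableAt (by fun_prop), hconst z, deriv_const_mul_id', sub_self]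
    intro z
    have := is_const_of_deriv_eq_zero h1 h2 z 0
    simp only [mul_zero, sub_zero] at this
    linear_combination this
  have hAm : ∀ w ∈ m.lattice, A w = deriv H 0 * w := by
    intro w hw
    have h1 := hA w hw 0
    rw [hlin, hlin 0] at h1
    linear_combination -h1
  obtain ⟨F, hF, hFp⟩ := m.exists_isLift_hasPeriods
  obtain ⟨G, hG, hGp⟩ := n.exists_isLift_hasPeriods
  have hcomp : (n.periodMap : ℂ →L[ℝ] ℂ).comp A = m.periodMap :=
    (homotopic_iff (f₀ := ((h.trans n.marking : Torus m.lattice ≃ₜ Torus gaussianLattice) :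
      C(Torus m.lattice, Torus gaussianLattice))) (f₁ := (m.marking : C(_, _)))
      (hG.comp hl) hF (hA.comp hl hGp) hFp).1 hhom
  have hA' : A = m.transition n := by
    ext z
    apply n.periodMap.injective
    have := congrArg (fun T : ℂ →L[ℝ] ℂ => T z) hcomp
    simpa [transition] using this
  have e1 : n.period₁ = deriv H 0 * m.period₁ := by
    rw [← m.transition_period₁ n, ← hAm _ (by
      rw [← periodMap_mem, periodMap_period₁]; exact one_mem_gaussianLattice), hA']
    rfl
  have e2 : n.period₂ = deriv H 0 * m.period₂ := by
    rw [← m.transition_period₂ n, ← hAm _ (by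
      rw [← periodMap_mem, periodMap_period₂]; exact I_mem_gaussianLattice), hA']
    rfl
  have h0 : deriv H 0 ≠ 0 := fun h0 => n.period₁_ne_zero (by rw [e1, h0, zero_mul])
  apply UpperHalfPlane.ext
  rw [coe_modulus, coe_modulus, e1, e2, mul_div_mul_left _ _ h0]

/-- With equal moduli the transition map is multiplication by `n.period₁ / m.period₁`, so the linear
map and its inverse are holomorphic. -/
theorem equivalent_of_modulus_eq (h : m.modulus = n.modulus) : m.Equivalent n := by
  set a : ℂ := n.period₁ / m.period₁ with ha
  have ha0 : a ≠ 0 := div_ne_zero n.period₁_ne_zero m.period₁_ne_zero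
  have e1 : n.period₁ = a * m.period₁ := (div_mul_cancel₀ _ m.period₁_ne_zero).symm
  have htr : (m.transition n : ℂ →L[ℝ] ℂ) = ContinuousLinearMap.mul ℝ ℂ a := by
    apply m.clm_ext_periods
    · simp [e1]
    · simp only [ContinuousLinearEquiv.coe_coe, transition_period₂, ContinuousLinearMap.mul_apply']
      rw [period₂_eq, period₂_eq, h, e1]; ring
  have htr1 : ∀ z, m.transition n z = a * z := fun z =>
    congrArg (fun T : ℂ →L[ℝ] ℂ => T z) htr
  have htr2 : ∀ z, (m.transition n).symm z = a⁻¹ * z := fun z => by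
    rw [ContinuousLinearEquiv.symm_apply_eq, htr1, mul_inv_cancel_left₀ ha0]
  refine ⟨m.linearMap n, ⟨_, ?_, m.isLift_linearMap n⟩,
    ⟨_, ?_, isLift_linearHomeomorph_symm _ (m.transition_mem n)⟩, ?_⟩
  · rw [funext htr1]; fun_prop
  · rw [funext htr2]; fun_prop
  · obtain ⟨F, hF, hFp⟩ := m.exists_isLift_hasPeriods
    obtain ⟨G, hG, hGp⟩ := n.exists_isLift_hasPeriods
    refine (homotopic_iff (f₀ := (((m.linearMap n).trans n.marking :
        Torus m.lattice ≃ₜ Torus gaussianLattice) :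
      C(Torus m.lattice, Torus gaussianLattice))) (f₁ := (m.marking : C(_, _)))
      (hG.comp (m.isLift_linearMap n)) hF
      ((hasPeriods_linear m.lattice (m.transition n : ℂ →L[ℝ] ℂ)).comp
        (m.isLift_linearMap n) hGp) hFp).2 ?_
    ext z
    simp [transition]

/-- The real linear isomorphism that takes `1` and `τ` to `1` and `i`. -/
def normalizingMap (τ : ℍ) : ℂ ≃L[ℝ] ℂ :=
  ContinuousLinearEquiv.equivOfInverse
    (Complex.reCLM.smulRight (1 : ℂ) +
      Complex.imCLM.smulRight ((Complex.I - (τ : ℂ).re) / (τ : ℂ).im))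
    (Complex.reCLM.smulRight (1 : ℂ) + Complex.imCLM.smulRight (τ : ℂ))
    (fun z => by
      have h : (τ : ℂ).im ≠ 0 := τ.im_ne_zero
      have h1 : ((Complex.I - (τ : ℂ).re) / (τ : ℂ).im).re = -(τ : ℂ).re / (τ : ℂ).im := by
        rw [Complex.div_ofReal_re]; simp
      have h2 : ((Complex.I - (τ : ℂ).re) / (τ : ℂ).im).im = 1 / (τ : ℂ).im := by
        rw [Complex.div_ofReal_im]; simp
      apply Complex.ext <;>
        simp [h1, h2, -UpperHalfPlane.coe_re, -UpperHalfPlane.coe_im] <;> field_simp <;> ring)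
    (fun z => by
      have h : (τ : ℂ).im ≠ 0 := τ.im_ne_zero
      have h1 : ((Complex.I - (τ : ℂ).re) / (τ : ℂ).im).re = -(τ : ℂ).re / (τ : ℂ).im := by
        rw [Complex.div_ofReal_re]; simp
      have h2 : ((Complex.I - (τ : ℂ).re) / (τ : ℂ).im).im = 1 / (τ : ℂ).im := by
        rw [Complex.div_ofReal_im]; simp
      apply Complex.ext <;>
        simp [h1, h2, -UpperHalfPlane.coe_re, -UpperHalfPlane.coe_im] <;> field_simp <;> ring)

theorem normalizingMap_symm_one (τ : ℍ) : (normalizingMap τ).symm 1 = 1 := by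
  change (Complex.reCLM.smulRight (1 : ℂ) + Complex.imCLM.smulRight (τ : ℂ)) 1 = 1
  simp

theorem normalizingMap_symm_I (τ : ℍ) : (normalizingMap τ).symm Complex.I = τ := by
  change (Complex.reCLM.smulRight (1 : ℂ) + Complex.imCLM.smulRight (τ : ℂ)) Complex.I = τ
  simp

theorem normalizingMap_det_pos (τ : ℍ) : 0 < (normalizingMap τ : ℂ →L[ℝ] ℂ).det := by
  have h := im_conj_mul_clm_apply (normalizingMap τ : ℂ →L[ℝ] ℂ) 1 τ
  rw [ContinuousLinearEquiv.coe_coe, (normalizingMap τ).symm_apply_eq.1 (normalizingMap_symm_one τ)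
    |>.symm, (normalizingMap τ).symm_apply_eq.1 (normalizingMap_symm_I τ) |>.symm] at h
  simp at h
  exact pos_of_mul_pos_left (h ▸ one_pos) τ.im_pos.le

/-- The torus `ℂ / (ℤ + τℤ)` with its standard marking. -/
def ofModulus (τ : ℍ) : MarkedTorus where
  lattice := ZLattice.comap ℝ gaussianLattice (normalizingMap τ : ℂ ≃L[ℝ] ℂ).toLinearMap
  discrete := inferInstance
  isZLattice := inferInstance
  marking := linearHomeomorph (normalizingMap τ) fun _ => Iff.rfl
  orientation := ⟨normalizingMap τ, isLift_linearHomeomorph _ _, fun z r hr => by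
    simpa [map_add] using windsOnce_linear (normalizingMap_det_pos τ) hr⟩

theorem modulus_ofModulus (τ : ℍ) : (ofModulus τ).modulus = τ := by
  have h : (normalizingMap τ : ℂ →L[ℝ] ℂ) = (ofModulus τ).periodMap :=
    (ofModulus τ).eq_periodMap (isLift_linearHomeomorph (normalizingMap τ) fun _ => Iff.rfl)
      (hasPeriods_linear _ (normalizingMap τ : ℂ →L[ℝ] ℂ))
  have h' : normalizingMap τ = (ofModulus τ).periodMap :=
    ContinuousLinearEquiv.ext (funext fun z => congrArg (fun T : ℂ →L[ℝ] ℂ => T z) h)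
  apply UpperHalfPlane.ext
  rw [coe_modulus, period₁, period₂, ← h', normalizingMap_symm_one, normalizingMap_symm_I, div_one]

end MarkedTorus

/-! ### Lipschitz maps between flat tori -/

/-- The projection to the torus preserves small norms. -/
theorem exists_norm_proj_eq (Λ : Submodule ℤ ℂ) [DiscreteTopology Λ] :
    ∃ ε > 0, ∀ z : ℂ, ‖z‖ < ε → ‖proj Λ z‖ = ‖z‖ := by
  obtain ⟨ε, hε, h⟩ := Metric.isOpen_singleton_iff.1 (isOpen_discrete ({0} : Set Λ))
  -- Nonzero lattice points have norm at least `ε`, so for `‖z‖ < ε / 2` any other representative of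
  -- its class has norm above `ε / 2`.
  refine ⟨ε / 2, by positivity, fun z hz => le_antisymm (Submodule.Quotient.norm_mk_le Λ z) ?_⟩
  refine QuotientAddGroup.le_norm_iff.2 fun w hw => ?_
  have hmem : w - z ∈ Λ := proj_eq_proj.1 hw
  by_cases hwz : w - z = 0
  · rw [sub_eq_zero.1 hwz]
  · have h1 : ε ≤ ‖w - z‖ := by
      by_contra! hlt
      exact hwz (congrArg Subtype.val (h ⟨w - z, hmem⟩ (by simpa [dist_eq_norm] using hlt)))
    have := norm_sub_le w z
    linarith

theorem norm_torus_pos [DiscreteTopology Λ] {x : Torus Λ} (hx : x ≠ 0) : 0 < ‖x‖ := by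
  obtain ⟨ε, hε, h⟩ := exists_norm_proj_eq Λ
  refine lt_of_le_of_ne (norm_nonneg x) fun h0 => hx ?_
  obtain ⟨w, rfl, hw⟩ := Submodule.Quotient.norm_mk_lt x hε
  rw [← h0, zero_add] at hw
  rw [norm_eq_zero.1 ((h w hw).symm.trans h0.symm)]
  rfl

theorem compactSpace_torus (Λ : Submodule ℤ ℂ) [DiscreteTopology Λ] [IsZLattice ℝ Λ] :
    CompactSpace (Torus Λ) := by
  have h := IsZLattice.isCompact_range_of_periodic Λ (proj Λ) (continuous_proj Λ)
    fun z w hw => proj_add_of_mem hw z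
  rw [(proj_surjective Λ).range_eq] at h
  exact ⟨h⟩

theorem norm_proj_clm_le (A : ℂ →L[ℝ] ℂ) (hA : ∀ w ∈ Λ, A w ∈ Λ') {M : ℝ}
    (hM : ∀ z, ‖A z‖ ≤ M * ‖z‖) (z : ℂ) : ‖proj Λ' (A z)‖ ≤ M * ‖proj Λ z‖ := by
  have hM0 : 0 ≤ M := by simpa using (norm_nonneg _).trans (hM 1)
  refine le_of_forall_pos_le_add fun ε hε => ?_
  -- A nearly shortest representative; `M + 1` in the denominator covers `M = 0`.
  obtain ⟨w, hw, hwn⟩ := Submodule.Quotient.norm_mk_lt (proj Λ z) (ε := ε / (M + 1)) (by positivity)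
  have h1 : proj Λ' (A z) = proj Λ' (A w) := by
    rw [proj_eq_proj, ← map_sub]; exact hA _ (proj_eq_proj.1 hw.symm)
  calc ‖proj Λ' (A z)‖ ≤ ‖A w‖ := h1 ▸ Submodule.Quotient.norm_mk_le Λ' (A w)
    _ ≤ M * ‖w‖ := hM w
    _ ≤ M * (‖proj Λ z‖ + ε / (M + 1)) := by gcongr
    _ = M * ‖proj Λ z‖ + M / (M + 1) * ε := by ring
    _ ≤ M * ‖proj Λ z‖ + 1 * ε := by
        gcongr
        rw [div_le_one (by positivity)]; linarith
    _ = _ := by ring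

/-- The Lipschitz constant of a map of flat tori bounds the norm of the linear map
describing its periods. -/
theorem HasPeriods.norm_le_of_lipschitz [DiscreteTopology Λ] [IsZLattice ℝ Λ]
    [DiscreteTopology Λ'] {g : Torus Λ → Torus Λ'} {F : ℂ → ℂ} {A : ℂ →L[ℝ] ℂ}
    (hF : IsLift g F) (hA : HasPeriods Λ F A) {L : ℝ}
    (hL : ∀ x y, x ≠ y → ‖g x - g y‖ ≤ L * ‖x - y‖) (v : ℂ) : ‖A v‖ ≤ L * ‖v‖ := by
  obtain ⟨C, hC⟩ := hA.exists_norm_sub_le hF.1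
  obtain ⟨ε, hε, hε'⟩ := exists_norm_proj_eq Λ
  obtain ⟨η, hη, hη'⟩ := exists_norm_proj_eq Λ'
  have huc : UniformContinuous F := by
    -- The periodic part descends to a continuous function on the compact torus.
    have h0 : UniformContinuous fun z => F z - A z := by
      let G : Torus Λ → ℂ := Quotient.lift (fun z => F z - A z) (by
        intro z w hzw
        have h1 : z - w ∈ Λ := proj_eq_proj.1 (Quotient.sound hzw)
        have h2 := hA _ h1 w
        rw [add_sub_cancel, map_sub] at h2
        change F z - A z = F w - A w
        rw [h2]; ring)
      have hG : Continuous G := (isOpenQuotientMap_proj Λ).isQuotientMap.continuous_iff.2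
        (hF.1.sub A.continuous)
      have : CompactSpace (Torus Λ) := compactSpace_torus Λ
      have hp : UniformContinuous (proj Λ) :=
        (LipschitzWith.of_dist_le_mul (K := 1) fun z w => by
          rw [dist_eq_norm, dist_eq_norm, ← Submodule.Quotient.mk_sub, NNReal.coe_one, one_mul]
          exact Submodule.Quotient.norm_mk_le Λ _).uniformContinuous
      exact (CompactSpace.uniformContinuous_of_continuous hG).comp hp
    simpa using h0.add A.uniformContinuous
  obtain ⟨δ, hδ, hδ'⟩ := Metric.uniformContinuous_iff.1 huc η hη
  by_cases hv : v = 0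
  · simp [hv]
  have hvn : 0 < ‖v‖ := norm_pos_iff.2 hv
  obtain ⟨k, hk⟩ := exists_nat_gt (‖v‖ / min ε δ)
  have hk0 : (0 : ℝ) < k := (by positivity : (0:ℝ) ≤ ‖v‖ / min ε δ).trans_lt hk
  -- A step so short that both projections are isometric on the displacements it causes; the
  -- Lipschitz bound on the torus then passes to the lift.
  set u : ℂ := ((k : ℝ)⁻¹ : ℝ) • v with hu
  have hun : ‖u‖ < min ε δ := by
    rw [hu, norm_smul, Real.norm_eq_abs, abs_of_pos (by positivity), inv_mul_lt_iff₀ hk0]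
    rwa [div_lt_iff₀ (lt_min hε hδ)] at hk
  have hu0 : u ≠ 0 := smul_ne_zero (by positivity) hv
  have hstep : ∀ z, ‖F (z + u) - F z‖ ≤ L * ‖u‖ := by
    intro z
    have h1 : ‖F (z + u) - F z‖ < η := by
      rw [← dist_eq_norm]
      exact hδ' (by simpa [dist_eq_norm] using hun.trans_le (min_le_right _ _))
    have h2 : ‖proj Λ u‖ = ‖u‖ := hε' u (hun.trans_le (min_le_left _ _))
    have h3 : proj Λ (z + u) - proj Λ z = proj Λ u := by
      rw [← Submodule.Quotient.mk_sub, add_sub_cancel_left]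
    have hne : proj Λ (z + u) ≠ proj Λ z := by
      intro h
      rw [h, sub_self] at h3
      rw [← h3, norm_zero] at h2
      exact hu0 (norm_eq_zero.1 h2.symm)
    have h4 := hL _ _ hne
    rwa [← hF.2, ← hF.2, ← Submodule.Quotient.mk_sub, hη' _ h1, h3, h2] at h4
  have hsum : ∀ N : ℕ, ‖F (N * u) - F 0‖ ≤ N * (L * ‖u‖) := by
    intro N
    induction N with
    | zero => simp
    | succ N ih =>
      have e : ((N + 1 : ℕ) : ℂ) * u = N * u + u := by push_cast; ring
      rw [e]
      calc ‖F (N * u + u) - F 0‖ = ‖(F (N * u + u) - F (N * u)) + (F (N * u) - F 0)‖ := by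
            congr 1; ring
        _ ≤ L * ‖u‖ + N * (L * ‖u‖) := (norm_add_le _ _).trans (add_le_add (hstep _) ih)
        _ = _ := by push_cast; ring
  -- Chaining `N` steps gives `N * ‖A u‖ ≤ N * L * ‖u‖ + 2 * C`; let `N` grow.
  have hAu : ‖A u‖ ≤ L * ‖u‖ := by
    by_contra! hlt
    obtain ⟨N, hN⟩ := exists_nat_gt (2 * C / (‖A u‖ - L * ‖u‖))
    rw [div_lt_iff₀ (sub_pos.2 hlt)] at hN
    have e : A (N * u) = (F (N * u) - F 0) - ((F (N * u) - A (N * u)) - (F 0 - A 0)) := by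
      rw [map_zero]; ring
    have h1 : ‖A (N * u)‖ ≤ N * (L * ‖u‖) + (C + C) := by
      rw [e]
      exact (norm_sub_le _ _).trans (add_le_add (hsum N)
        ((norm_sub_le _ _).trans (add_le_add (hC _) (hC _))))
    have h2 : A (N * u) = N * A u := by
      rw [← nsmul_eq_mul, map_nsmul, nsmul_eq_mul]
    rw [h2, norm_mul, Complex.norm_natCast] at h1
    linarith
  rw [hu, map_smul, norm_smul, norm_smul, mul_left_comm] at hAu
  exact le_of_mul_le_mul_left hAu (by
    rw [Real.norm_eq_abs, abs_pos]; positivity)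

/-! ### Hyperbolic distance as stretch, and Thurston's function -/

namespace MarkedTorus

variable (m n : MarkedTorus)

/-- The square of the maximal stretching of the linear map between two marked tori,
in terms of the hyperbolic distance of the moduli. -/
theorem stretch_sq : (‖dzPart (m.transition n)‖ + ‖dzbarPart (m.transition n)‖) ^ 2 =
    Real.exp (dist m.modulus n.modulus) * (m.transition n : ℂ →L[ℝ] ℂ).det := by
  set a := dzPart (m.transition n) with ha
  set b := dzbarPart (m.transition n) with hb
  have h1 : a * m.period₁ + b * conj m.period₁ = n.period₁ := by
    rw [← clm_apply_eq]; simp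
  have h2 : a * m.period₂ + b * conj m.period₂ = n.period₂ := by
    rw [← clm_apply_eq]; simp
  have hdet := m.det_transition_mul_im n
  rw [im_conj_mul_eq, im_conj_mul_eq, ← coe_modulus, ← coe_modulus, UpperHalfPlane.coe_im,
    UpperHalfPlane.coe_im] at hdet
  rw [m.period₂_eq, n.period₂_eq, map_mul] at h2
  set p := m.period₁ with hp
  set q := n.period₁ with hq
  have hp0 : 0 < ‖p‖ := norm_pos_iff.2 m.period₁_ne_zero
  have hq0 : 0 < ‖q‖ := norm_pos_iff.2 n.period₁_ne_zero
  generalize m.modulus = τ at *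
  generalize n.modulus = σ at *
  have hτ := τ.im_pos
  have hσ := σ.im_pos
  have him : ‖(τ : ℂ) - conj (τ : ℂ)‖ = 2 * τ.im := by
    rw [Complex.sub_conj, norm_mul, Complex.norm_I, mul_one, Complex.norm_real, Real.norm_eq_abs,
      UpperHalfPlane.coe_im, abs_of_pos (by positivity)]
  -- Eliminating between `h1` and `h2` yields `b p̄ (τ - τ̄) = q (τ - σ)` and `a p (τ - τ̄) = q (σ -
  -- τ̄)`.
  have hb' : ‖b‖ * ‖p‖ * (2 * τ.im) = ‖q‖ * dist (τ : ℂ) σ := by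
    rw [← RCLike.norm_conj p, ← him, dist_eq_norm, ← norm_mul, ← norm_mul, ← norm_mul]
    congr 1
    linear_combination (τ : ℂ) * h1 - h2
  have ha' : ‖a‖ * ‖p‖ * (2 * τ.im) = ‖q‖ * dist (τ : ℂ) (conj (σ : ℂ)) := by
    rw [← Complex.dist_conj_comm, dist_comm, ← him, dist_eq_norm, ← norm_mul, ← norm_mul,
      ← norm_mul]
    congr 1
    linear_combination h2 - conj (τ : ℂ) * h1
  have hexp : Real.exp (dist τ σ) =
      ((dist (τ : ℂ) σ + dist (τ : ℂ) (conj (σ : ℂ)))) ^ 2 / (4 * (τ.im * σ.im)) := by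
    have : Real.exp (dist τ σ) = Real.exp (dist τ σ / 2) ^ 2 := by
      rw [← Real.exp_nat_mul]; congr 1; push_cast; ring
    rw [this, UpperHalfPlane.exp_half_dist, div_pow, mul_pow, Real.sq_sqrt (by positivity)]
    norm_num
  have hs : (‖a‖ + ‖b‖) * (‖p‖ * (2 * τ.im)) =
      ‖q‖ * (dist (τ : ℂ) σ + dist (τ : ℂ) (conj (σ : ℂ))) := by
    linear_combination ha' + hb'
  have hd : (m.transition n : ℂ →L[ℝ] ℂ).det = ‖q‖ ^ 2 * σ.im / (‖p‖ ^ 2 * τ.im) := by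
    rw [eq_div_iff (by positivity)]; exact hdet
  have hs' : ‖a‖ + ‖b‖ = ‖q‖ * (dist (τ : ℂ) σ + dist (τ : ℂ) (conj (σ : ℂ))) /
      (‖p‖ * (2 * τ.im)) := by
    rw [eq_div_iff (by positivity)]; exact hs
  rw [hs', hexp, hd]
  field_simp
  norm_num

theorem covolume_eq : ZLattice.covolume n.lattice =
    (m.transition n : ℂ →L[ℝ] ℂ).det * ZLattice.covolume m.lattice := by
  rw [covolume_eq_det_mul (m.transition n) (m.transition_mem n),
    abs_of_pos (m.det_transition_pos n)]

theorem stretch_div_sqrt_covolume :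
    (‖dzPart (m.transition n)‖ + ‖dzbarPart (m.transition n)‖) / √(ZLattice.covolume n.lattice) *
      √(ZLattice.covolume m.lattice) = Real.exp (dist m.modulus n.modulus / 2) := by
  have hd := m.det_transition_pos n
  have hm := ZLattice.covolume_pos m.lattice MeasureTheory.volume
  have hs := m.stretch_sq n
  have hexp : Real.exp (dist m.modulus n.modulus) =
      Real.exp (dist m.modulus n.modulus / 2) ^ 2 := by
    rw [← Real.exp_nat_mul]; congr 1; push_cast; ring
  have h1 : ‖dzPart (m.transition n)‖ + ‖dzbarPart (m.transition n)‖ =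
      Real.exp (dist m.modulus n.modulus / 2) * √(m.transition n : ℂ →L[ℝ] ℂ).det := by
    rw [← sq_eq_sq₀ (by positivity) (by positivity), hs, mul_pow, Real.sq_sqrt hd.le, hexp]
  rw [h1, m.covolume_eq n, Real.sqrt_mul hd.le]
  have := Real.sqrt_pos.2 hd
  have := Real.sqrt_pos.2 hm
  field_simp

theorem flatDist_linearMap_le (x y : Torus m.lattice) :
    n.flatDist (m.linearMap n x) (m.linearMap n y) ≤
      Real.exp (dist m.modulus n.modulus / 2) * m.flatDist x y := by
  obtain ⟨z, rfl⟩ := proj_surjective _ x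
  obtain ⟨w, rfl⟩ := proj_surjective _ y
  have h := norm_proj_clm_le (Λ := m.lattice) (Λ' := n.lattice) (m.transition n : ℂ →L[ℝ] ℂ)
    (fun w hw => (m.transition_mem n w).2 hw) (norm_clm_apply_le _) (z - w)
  have hm := Real.sqrt_pos.2 (ZLattice.covolume_pos m.lattice MeasureTheory.volume)
  have hn := Real.sqrt_pos.2 (ZLattice.covolume_pos n.lattice MeasureTheory.volume)
  rw [flatDist, flatDist, ← m.stretch_div_sqrt_covolume n]
  rw [map_sub] at h
  calc _ ≤ _ := div_le_div_of_nonneg_right h hn.le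
    _ = _ := by
      rw [← Submodule.Quotient.mk_sub]
      field_simp

theorem lipConst_linearMap_le : lipConst m n (m.linearMap n) ≤
    ENNReal.ofReal (Real.exp (dist m.modulus n.modulus / 2)) := by
  refine iSup_le fun x => iSup_le fun y => iSup_le fun _ => ENNReal.ofReal_le_ofReal ?_
  exact div_le_of_le_mul₀ (div_nonneg (norm_nonneg _) (Real.sqrt_nonneg _)) (Real.exp_pos _).le
    (m.flatDist_linearMap_le n x y)

/-- The linear model of any competitor is the transition map, and its direction of maximal stretch
already forces this constant once areas are normalized. -/
theorem le_lipConst {φ : C(Torus m.lattice, Torus n.lattice)} (hφ : m.RespectsMarkings n φ) :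
    ENNReal.ofReal (Real.exp (dist m.modulus n.modulus / 2)) ≤ lipConst m n φ := by
  by_cases htop : lipConst m n φ = ⊤
  · rw [htop]; exact le_top
  obtain ⟨F, hF⟩ := exists_isLift (Λ' := n.lattice) φ.continuous
  obtain ⟨A, hA⟩ := hF.exists_hasPeriods
  obtain rfl := (m.respectsMarkings_iff n hF hA).1 hφ
  have hm := Real.sqrt_pos.2 (ZLattice.covolume_pos m.lattice MeasureTheory.volume)
  have hn := Real.sqrt_pos.2 (ZLattice.covolume_pos n.lattice MeasureTheory.volume)
  set K := (lipConst m n φ).toReal with hK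
  have hL : ∀ x y, x ≠ y → ‖φ x - φ y‖ ≤
      K * √(ZLattice.covolume n.lattice) / √(ZLattice.covolume m.lattice) * ‖x - y‖ := by
    intro x y hxy
    have hx : 0 < ‖x - y‖ := norm_torus_pos (sub_ne_zero.2 hxy)
    have h1 : ENNReal.ofReal (n.flatDist (φ x) (φ y) / m.flatDist x y) ≤ lipConst m n φ :=
      le_iSup_of_le x (le_iSup_of_le y (le_iSup_of_le hxy le_rfl))
    rw [ENNReal.ofReal_le_iff_le_toReal htop, ← hK, flatDist, flatDist,
      div_le_iff₀ (by positivity), div_le_iff₀ hn] at h1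
    refine h1.trans_eq ?_
    field_simp
  obtain ⟨v, hv, hv'⟩ := exists_norm_clm_apply_eq (m.transition n)
  have h := hA.norm_le_of_lipschitz hF hL v
  rw [hv', hv, mul_one] at h
  rw [ENNReal.ofReal_le_iff_le_toReal htop, ← m.stretch_div_sqrt_covolume n, ← hK,
    div_mul_eq_mul_div, div_le_iff₀ hn]
  rwa [le_div_iff₀ hm] at h

theorem thurstonLambda_eq :
    thurstonLambda m n = ((dist m.modulus n.modulus / 2 : ℝ) : EReal) := by
  have hlog : ENNReal.log (ENNReal.ofReal (Real.exp (dist m.modulus n.modulus / 2))) =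
      ((dist m.modulus n.modulus / 2 : ℝ) : EReal) := by
    rw [ENNReal.log_ofReal_of_pos (Real.exp_pos _), Real.log_exp]
  rw [← hlog]
  refine le_antisymm ?_ ?_
  · refine iInf_le_of_le (m.linearMap n : C(_, _)) (iInf_le_of_le (m.respectsMarkings_linearMap n)
      (iInf_le_of_le ?_ ?_))
    · exact ((m.lipConst_linearMap_le n).trans_lt ENNReal.ofReal_lt_top).ne
    · exact ENNReal.log_monotone (m.lipConst_linearMap_le n)
  · exact le_iInf fun φ => le_iInf fun hφ => le_iInf fun _ =>
      ENNReal.log_monotone (m.le_lipConst n hφ)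

end MarkedTorus

/-! ### The length-area method -/

theorem countable_lattice (Λ : Submodule ℤ ℂ) [DiscreteTopology Λ] [IsZLattice ℝ Λ] :
    Countable Λ := inferInstance

instance [DiscreteTopology Λ] : MeasurableVAdd Λ ℂ :=
  (inferInstance : MeasurableVAdd Λ.toAddSubgroup ℂ)

instance : VAddInvariantMeasure Λ ℂ volume :=
  (inferInstance : VAddInvariantMeasure Λ.toAddSubgroup ℂ volume)

theorem countable_preimage_proj [DiscreteTopology Λ] [IsZLattice ℝ Λ] {E : Set (Torus Λ)}
    (hE : E.Finite) : (proj Λ ⁻¹' E).Countable := by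
  have h : ∀ x : Torus Λ, (proj Λ ⁻¹' {x}).Countable := by
    intro x
    obtain ⟨w, rfl⟩ := proj_surjective Λ x
    refine (Set.countable_range (fun l : Λ => w + (l : ℂ))).mono fun z hz => ?_
    exact ⟨⟨z - w, proj_eq_proj.1 hz⟩, by simp⟩
  rw [← Set.biUnion_of_singleton E, Set.preimage_iUnion₂]
  exact hE.countable.biUnion fun x _ => h x

/-- Almost every line in a given direction avoids a given countable set. -/
theorem ae_line_avoids {S : Set ℂ} (hS : S.Countable) (v : ℂ) :
    ∀ᵐ z : ℂ, ∀ t : ℝ, z + t * v ∉ S := by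
  have hV : (Submodule.span ℝ {v}) ≠ ⊤ := by
    intro h
    have h1 := finrank_span_le_card (R := ℝ) ({v} : Set ℂ)
    rw [h, finrank_top, Complex.finrank_real_complex] at h1
    simp at h1
  have h0 : volume (⋃ s ∈ S, (fun z => z + -s) ⁻¹' (Submodule.span ℝ {v} : Set ℂ)) = 0 := by
    rw [measure_biUnion_null_iff hS]
    intro s _
    rw [measure_preimage_add_right]
    exact Measure.addHaar_submodule _ _ hV
  rw [ae_iff]
  refine measure_mono_null (fun z hz => ?_) h0
  simp only [not_forall, not_not, Set.mem_ofPred_eq] at hz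
  obtain ⟨t, ht⟩ := hz
  refine Set.mem_biUnion ht ?_
  change z + -(z + t * v) ∈ Submodule.span ℝ {v}
  rw [Submodule.mem_span_singleton]
  exact ⟨-t, by simp⟩

theorem enorm_sub_le_lintegral_fderiv {F : ℂ → ℂ} {z v : ℂ}
    (hF : ∀ t : ℝ, ContDiffAt ℝ ∞ F (z + t * v)) :
    ‖F (z + v) - F z‖ₑ ≤ ∫⁻ t in Set.Ioc (0 : ℝ) 1, ‖fderiv ℝ F (z + t * v) v‖ₑ := by
  have hl : ∀ t : ℝ, HasDerivAt (fun t : ℝ => z + t * v) v t := by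
    intro t
    simpa using ((Complex.ofRealCLM.hasDerivAt (x := t)).mul_const v).const_add z
  have hd : ∀ t : ℝ, HasDerivAt (fun t : ℝ => F (z + t * v)) (fderiv ℝ F (z + t * v) v) t :=
    fun t => ((hF t).differentiableAt (by simp)).hasFDerivAt.comp_hasDerivAt t (hl t)
  have hc : Continuous fun t : ℝ => fderiv ℝ F (z + t * v) v := by
    rw [continuous_iff_continuousAt]
    intro t
    have h1 : ContinuousAt (fderiv ℝ F) (z + t * v) :=
      ((hF t).fderiv_right (m := 0) (by simp)).continuousAt
    have h2 : ContinuousAt (fun t : ℝ => fderiv ℝ F (z + t * v)) t :=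
      ContinuousAt.comp (f := fun t : ℝ => z + t * v) h1 (hl t).continuousAt
    exact h2.clm_apply continuousAt_const
  have h := intervalIntegral.integral_eq_sub_of_hasDerivAt (a := 0) (b := 1) (fun t _ => hd t)
    (hc.intervalIntegrable 0 1)
  rw [intervalIntegral.integral_of_le zero_le_one] at h
  simp only [Complex.ofReal_one, one_mul, Complex.ofReal_zero, zero_mul, add_zero] at h
  rw [← h]
  exact enorm_integral_le_lintegral_enorm _

/-- The integral of a periodic function over a fundamental domain is translation invariant. -/
theorem setLIntegral_add_eq_of_periodic [Countable Λ] [MeasurableVAdd Λ ℂ] {Ω : Set ℂ}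
    (hΩ : IsAddFundamentalDomain Λ Ω volume) {f : ℂ → ENNReal}
    (hper : ∀ l ∈ Λ, ∀ z, f (z + l) = f z) (c : ℂ) :
    ∫⁻ z in Ω, f (z + c) = ∫⁻ z in Ω, f z := by
  have h1 : IsAddFundamentalDomain Λ (c +ᵥ Ω) volume := hΩ.vadd_of_comm c
  have h2 : ∫⁻ z in c +ᵥ Ω, f z = ∫⁻ z in Ω, f z :=
    h1.setLIntegral_eq hΩ f fun l z => by
      change f ((l : ℂ) + z) = f z
      rw [add_comm]; exact hper l l.2 z
  rw [← h2]
  have h3 := (measurePreserving_add_right (volume : Measure ℂ) c).setLIntegral_comp_preimage_emb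
    (measurableEmbedding_addRight c) f (c +ᵥ Ω)
  rw [← h3]
  congr 2
  ext z
  simp [Set.mem_vadd_set_iff_neg_vadd_mem]

/-- The mean of the directional derivative of an equivariant map in the direction `v`
is at least the displacement along `v`. -/
theorem HasPeriods.enorm_mul_le_lintegral [DiscreteTopology Λ] [IsZLattice ℝ Λ] {F : ℂ → ℂ}
    {A : ℂ →L[ℝ] ℂ} (hF : Continuous F) (hA : HasPeriods Λ F A) {S : Set ℂ} (hS : S.Countable)
    (hsm : ∀ z ∉ S, ContDiffAt ℝ ∞ F z) {Ω : Set ℂ} (hΩ : IsAddFundamentalDomain Λ Ω volume)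
    (hΩt : volume Ω ≠ ⊤) (v : ℂ) :
    ENNReal.ofReal ‖A v‖ * volume Ω ≤ ∫⁻ z in Ω, ‖fderiv ℝ F z v‖ₑ := by
  have : Countable Λ := countable_lattice Λ
  obtain ⟨C, hC⟩ := hA.exists_norm_sub_le hF
  have hper : ∀ l ∈ Λ, ∀ z, fderiv ℝ F (z + l) = fderiv ℝ F z := by
    intro l hl z
    rw [← fderiv_comp_add_right]
    have : (fun x => F (x + l)) = fun x => F x + A l := funext fun x => hA l hl x
    rw [this, fderiv_add_const]
  set J := ∫⁻ z in Ω, ‖fderiv ℝ F z v‖ₑ with hJ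
  -- The displacement of `F` along `N * v` is at least `N * ‖A v‖ - 2 * C` and at most the integral
  -- of the derivative along the segment. Averaging over `Ω`, Tonelli and periodicity turn the
  -- latter into `N * J`; dividing by `N` later removes `C`.
  have key : ∀ N : ℕ, ENNReal.ofReal (N * ‖A v‖ - 2 * C) * volume Ω ≤ N * J := by
    intro N
    have h1 : ∀ z, ENNReal.ofReal (N * ‖A v‖ - 2 * C) ≤ ‖F (z + N * v) - F z‖ₑ := by
      intro z
      rw [← ofReal_norm]
      apply ENNReal.ofReal_le_ofReal
      have e : (N : ℂ) * A v = (F (z + N * v) - F z) -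
          ((F (z + N * v) - A (z + N * v)) - (F z - A z)) := by
        rw [map_add, ← nsmul_eq_mul, ← nsmul_eq_mul, map_nsmul]; ring
      have h2 : ‖(N : ℂ) * A v‖ ≤ ‖F (z + N * v) - F z‖ + (C + C) := by
        rw [e]
        exact (norm_sub_le _ _).trans (add_le_add le_rfl
          ((norm_sub_le _ _).trans (add_le_add (hC _) (hC _))))
      rw [norm_mul, Complex.norm_natCast] at h2
      linarith
    have hmeas : Measurable fun p : ℂ × ℝ => ‖fderiv ℝ F (p.1 + p.2 * (N * v)) (N * v)‖ₑ := by
      have h2 : Measurable fun p : ℂ × ℝ => p.1 + p.2 * (N * v) := by fun_prop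
      exact ((measurable_fderiv_apply_const ℝ F (N * v)).comp h2).enorm
    calc ENNReal.ofReal (N * ‖A v‖ - 2 * C) * volume Ω
        = ∫⁻ z in Ω, ENNReal.ofReal (N * ‖A v‖ - 2 * C) := by rw [setLIntegral_const]
      _ ≤ ∫⁻ z in Ω, ‖F (z + N * v) - F z‖ₑ := lintegral_mono fun z => h1 z
      _ ≤ ∫⁻ z in Ω, ∫⁻ t in Set.Ioc (0 : ℝ) 1, ‖fderiv ℝ F (z + t * (N * v)) (N * v)‖ₑ := by
          refine lintegral_mono_ae ?_
          -- The fundamental theorem of calculus is needed only on lines missing the exceptional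
          -- points, which is almost all of them.
          filter_upwards [ae_restrict_of_ae (ae_line_avoids hS (N * v))] with z hz
          exact enorm_sub_le_lintegral_fderiv fun t => hsm _ (hz t)
      _ = ∫⁻ t in Set.Ioc (0 : ℝ) 1, ∫⁻ z in Ω, ‖fderiv ℝ F (z + t * (N * v)) (N * v)‖ₑ :=
          lintegral_lintegral_swap hmeas.aemeasurable
      _ = ∫⁻ t in Set.Ioc (0 : ℝ) 1, N * J := by
          refine lintegral_congr fun t => ?_
          rw [setLIntegral_add_eq_of_periodic hΩ (f := fun z => ‖fderiv ℝ F z (N * v)‖ₑ)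
            (fun l hl z => by rw [hper l hl]) (t * (N * v)), hJ,
            ← lintegral_const_mul' _ _ (by simp)]
          refine lintegral_congr fun z => ?_
          rw [← nsmul_eq_mul, map_nsmul, nsmul_eq_mul, enorm_mul]
          congr 1
          rw [← ofReal_norm, Complex.norm_natCast, ENNReal.ofReal_natCast]
      _ = N * J := by simp
  by_cases hJt : J = ⊤
  · rw [hJt]; exact le_top
  have hreal : ∀ N : ℕ, (N * ‖A v‖ - 2 * C) * (volume Ω).toReal ≤ N * J.toReal := by
    intro N
    have h1 := ENNReal.toReal_mono (ENNReal.mul_ne_top (by simp) hJt) (key N)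
    rw [ENNReal.toReal_mul, ENNReal.toReal_mul, ENNReal.toReal_natCast] at h1
    refine le_trans ?_ h1
    gcongr
    rw [ENNReal.toReal_ofReal']
    exact le_max_left _ _
  rw [← ENNReal.ofReal_toReal hΩt, ← ENNReal.ofReal_toReal hJt,
    ← ENNReal.ofReal_mul (norm_nonneg _)]
  apply ENNReal.ofReal_le_ofReal
  by_contra! hlt
  obtain ⟨N, hN⟩ := exists_nat_gt
    (2 * C * (volume Ω).toReal / (‖A v‖ * (volume Ω).toReal - J.toReal))
  rw [div_lt_iff₀ (sub_pos.2 hlt)] at hN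
  have := hreal N
  linarith

/-- Finite dilatation forces `B = 0` or `|b| < |a|`. In the latter case `|det| = (|a| + |b|) (|a| -
|b|)` and `|a| + |b| ≤ K (|a| - |b|)`. -/
theorem sq_norm_le_of_dilatation_le {B : ℂ →L[ℝ] ℂ} {K : ENNReal} (hK : K ≠ ⊤)
    (h : dilatation B ≤ K) (v : ℂ) : ‖B v‖ ^ 2 ≤ K.toReal * ‖v‖ ^ 2 * |B.det| := by
  have h' : ENNReal.ofReal (‖dzPart B‖ + ‖dzbarPart B‖) /
    ENNReal.ofReal (‖dzPart B‖ - ‖dzbarPart B‖) ≤ K := h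
  have hB := norm_clm_apply_le B v
  rw [det_clm_eq]
  set a := ‖dzPart B‖ with ha
  set b := ‖dzbarPart B‖ with hb
  have ha0 : 0 ≤ a := norm_nonneg _
  have hb0 : 0 ≤ b := norm_nonneg _
  rcases (add_nonneg ha0 hb0).eq_or_lt with h0 | h0
  · rw [← h0, zero_mul] at hB
    have : ‖B v‖ = 0 := le_antisymm hB (norm_nonneg _)
    rw [this, zero_pow two_ne_zero]; positivity
  by_cases hab : a ≤ b
  · rw [ENNReal.ofReal_of_nonpos (sub_nonpos.2 hab), ENNReal.div_zero (by simpa using h0)] at h'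
    exact absurd (top_le_iff.1 h') hK
  push Not at hab
  have hsub : 0 < a - b := sub_pos.2 hab
  rw [← ENNReal.ofReal_div_of_pos hsub, ENNReal.ofReal_le_iff_le_toReal hK,
    div_le_iff₀ hsub] at h'
  have hdet : |a ^ 2 - b ^ 2| = (a + b) * (a - b) := by
    rw [abs_of_pos]
    · ring
    · nlinarith
  calc ‖B v‖ ^ 2 ≤ ((a + b) * ‖v‖) ^ 2 := by gcongr
    _ = (a + b) * (a + b) * ‖v‖ ^ 2 := by ring
    _ ≤ (a + b) * (K.toReal * (a - b)) * ‖v‖ ^ 2 := by gcongr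
    _ = _ := by rw [hdet]; ring

/-- The area of the image of a fundamental domain is at most the area of the torus. -/
theorem lintegral_det_fderiv_le [DiscreteTopology Λ] [DiscreteTopology Λ'] [IsZLattice ℝ Λ']
    {g : Torus Λ → Torus Λ'} (hg : Function.Injective g) {F : ℂ → ℂ} (hF : IsLift g F)
    {S : Set ℂ} (hS : S.Countable) (hsm : ∀ z ∉ S, ContDiffAt ℝ ∞ F z) {Ω Ω' : Set ℂ}
    (hΩm : MeasurableSet Ω) (hΩ : ∀ z ∈ Ω, ∀ w ∈ Ω, z - w ∈ Λ → z = w)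
    (hΩ' : IsAddFundamentalDomain Λ' Ω' volume) :
    ∫⁻ z in Ω, ENNReal.ofReal |(fderiv ℝ F z).det| ≤ volume Ω' := by
  have : Countable Λ' := countable_lattice Λ'
  have hSm : MeasurableSet (Ω \ S) := hΩm.diff hS.measurableSet
  have hd : ∀ z ∈ Ω \ S, HasFDerivWithinAt F (fderiv ℝ F z) (Ω \ S) z := fun z hz =>
    ((hsm z hz.2).differentiableAt (by simp)).hasFDerivAt.hasFDerivWithinAt
  have hinj' : ∀ z ∈ Ω, ∀ w ∈ Ω, F z - F w ∈ Λ' → z = w := by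
    intro z hz w hw h
    rw [← proj_eq_proj, hF.2, hF.2] at h
    exact hΩ z hz w hw (proj_eq_proj.1 (hg h))
  have hinj : Set.InjOn F (Ω \ S) := fun z hz w hw h =>
    hinj' z hz.1 w hw.1 (by rw [h, sub_self]; exact Λ'.zero_mem)
  rw [← setLIntegral_congr (sdiff_null_ae_eq_self (hS.measure_zero volume)),
    lintegral_abs_det_fderiv_eq_addHaar_image volume hSm hd hinj]
  -- Pigeonhole: an image of area larger than `Ω'` contains two points differing by a nonzero
  -- lattice vector, against injectivity of `g`.
  by_contra! hlt
  obtain ⟨x, ⟨z, hz, rfl⟩, y, ⟨w, hw, rfl⟩, l, hl, hlxy⟩ := hΩ'.exists_ne_zero_vadd_eq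
    (measurable_image_of_fderivWithin hSm hd hinj).nullMeasurableSet hlt
  have h1 : F w - F z = l := by rw [← hlxy]; exact add_sub_cancel_right _ _
  have h2 : w = z := hinj' w hw.1 z hz.1 (h1 ▸ l.2)
  rw [h2, sub_self] at h1
  exact hl (Subtype.ext h1.symm)

/-- Cauchy–Schwarz against the constant function `1`. -/
theorem sq_lintegral_le {α : Type*} [MeasurableSpace α] {μ : Measure α} {f : α → ENNReal}
    (hf : AEMeasurable f μ) : (∫⁻ x, f x ∂μ) ^ 2 ≤ μ Set.univ * ∫⁻ x, f x ^ 2 ∂μ := by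
  have h := ENNReal.lintegral_mul_le_Lp_mul_Lq μ Real.HolderConjugate.two_two hf
    (g := 1) aemeasurable_const
  simp only [Pi.mul_apply, Pi.one_apply, mul_one, ENNReal.one_rpow, lintegral_one] at h
  calc _ ≤ _ := pow_le_pow_left₀ zero_le h 2
    _ = _ := by
      rw [mul_pow, ← ENNReal.rpow_natCast, ← ENNReal.rpow_natCast, ← ENNReal.rpow_mul,
        ← ENNReal.rpow_mul, mul_comm]
      norm_num

/-- Grötzsch's inequality for homeomorphisms of tori, proved by the length-area method. -/
theorem groetzsch [DiscreteTopology Λ] [IsZLattice ℝ Λ] [DiscreteTopology Λ'] [IsZLattice ℝ Λ']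
    (g : Torus Λ ≃ₜ Torus Λ') {F : ℂ → ℂ} {A : ℂ →L[ℝ] ℂ} (hF : IsLift g F)
    (hA : HasPeriods Λ F A) {E : Set (Torus Λ)} (hE : E.Finite)
    (hsm : ∀ z, proj Λ z ∉ E → ContDiffAt ℝ ∞ F z) (hg : distortion g ≠ ⊤) (v : ℂ) :
    ‖A v‖ ^ 2 * ZLattice.covolume Λ ≤
      (distortion g).toReal * ‖v‖ ^ 2 * ZLattice.covolume Λ' := by
  have := ZLattice.module_free ℝ Λ
  have := ZLattice.module_finite ℝ Λ
  have := ZLattice.module_free ℝ Λ'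
  have := ZLattice.module_finite ℝ Λ'
  set K := distortion g with hK
  let b := Module.Free.chooseBasis ℤ Λ
  let b' := Module.Free.chooseBasis ℤ Λ'
  have hΩ := ZLattice.isAddFundamentalDomain b volume
  have hΩ' := ZLattice.isAddFundamentalDomain b' volume
  have hspan := b.ofZLatticeBasis_span ℝ
  set Ω := ZSpan.fundamentalDomain (b.ofZLatticeBasis ℝ Λ)
  set Ω' := ZSpan.fundamentalDomain (b'.ofZLatticeBasis ℝ Λ')
  have hc : ZLattice.covolume Λ = (volume Ω).toReal :=
    ZLattice.covolume_eq_measure_fundamentalDomain Λ volume hΩ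
  have hc' : ZLattice.covolume Λ' = (volume Ω').toReal :=
    ZLattice.covolume_eq_measure_fundamentalDomain Λ' volume hΩ'
  have ht : volume Ω ≠ ⊤ :=
    (ZSpan.fundamentalDomain_isBounded (b.ofZLatticeBasis ℝ Λ)).measure_lt_top.ne
  have ht' : volume Ω' ≠ ⊤ :=
    (ZSpan.fundamentalDomain_isBounded (b'.ofZLatticeBasis ℝ Λ')).measure_lt_top.ne
  have hpos : 0 < (volume Ω).toReal := hc ▸ ZLattice.covolume_pos Λ volume
  have hS := countable_preimage_proj hE
  have huniq : ∀ z ∈ Ω, ∀ w ∈ Ω, z - w ∈ Λ → z = w := by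
    intro z hz w hw h
    rw [← ZSpan.fract_eq_self] at hz hw
    rw [← hz, ← hw, ZSpan.fract_eq_fract, hspan]
    simpa [sub_eq_add_neg, add_comm] using Λ.neg_mem h
  have h1 := hA.enorm_mul_le_lintegral hF.1 hS hsm hΩ ht v
  have h2 := lintegral_det_fderiv_le g.injective hF hS hsm
    (ZSpan.fundamentalDomain_measurableSet (b.ofZLatticeBasis ℝ Λ)) huniq hΩ'
  have h3 := sq_lintegral_le (μ := volume.restrict Ω)
    ((measurable_fderiv_apply_const ℝ F v).enorm.aemeasurable)
  have h4 : ∫⁻ z in Ω, ‖fderiv ℝ F z v‖ₑ ^ 2 ≤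
      ENNReal.ofReal (K.toReal * ‖v‖ ^ 2) * ∫⁻ z in Ω, ENNReal.ofReal |(fderiv ℝ F z).det| := by
    rw [← lintegral_const_mul' _ _ ENNReal.ofReal_ne_top]
    refine lintegral_mono_ae ?_
    filter_upwards [ae_restrict_of_ae (hS.ae_notMem volume)] with z hz
    have hd : DifferentiableAt ℝ F z := (hsm z hz).differentiableAt (by simp)
    have hdil : dilatation (fderiv ℝ F z) ≤ K :=
      le_iSup_of_le F (le_iSup_of_le hF (le_iSup_of_le z (le_iSup_of_le hd le_rfl)))
    rw [← ENNReal.ofReal_mul (by positivity), ← ofReal_norm, ← ENNReal.ofReal_pow (norm_nonneg _)]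
    exact ENNReal.ofReal_le_ofReal (sq_norm_le_of_dilatation_le hg hdil v)
  -- Mean displacement, Cauchy–Schwarz, the pointwise dilatation bound and the area bound, in this
  -- order.
  have h5 : (ENNReal.ofReal ‖A v‖ * volume Ω) ^ 2 ≤
      volume Ω * (ENNReal.ofReal (K.toReal * ‖v‖ ^ 2) * volume Ω') := by
    refine (pow_le_pow_left₀ zero_le h1 2).trans (h3.trans ?_)
    rw [Measure.restrict_apply_univ]
    gcongr
    exact h4.trans (by gcongr)
  have h6 := ENNReal.toReal_mono (by finiteness) h5
  rw [ENNReal.toReal_pow, ENNReal.toReal_mul, ENNReal.toReal_mul, ENNReal.toReal_mul,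
    ENNReal.toReal_ofReal (norm_nonneg _), ENNReal.toReal_ofReal (by positivity)] at h6
  rw [hc, hc']
  refine le_of_mul_le_mul_left ?_ hpos
  linarith

/-! ### The Teichmüller distance -/

namespace MarkedTorus

variable (m n : MarkedTorus)

theorem dilatation_transition :
    dilatation (m.transition n) = ENNReal.ofReal (Real.exp (dist m.modulus n.modulus)) := by
  have hs := m.stretch_sq n
  have hd := m.det_transition_pos n
  change ENNReal.ofReal (‖dzPart (m.transition n)‖ + ‖dzbarPart (m.transition n)‖) /
    ENNReal.ofReal (‖dzPart (m.transition n)‖ - ‖dzbarPart (m.transition n)‖) = _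
  rw [det_clm_eq] at hs hd
  set a := ‖dzPart (m.transition n)‖ with ha
  set b := ‖dzbarPart (m.transition n)‖ with hb
  have ha0 : 0 ≤ a := norm_nonneg _
  have hb0 : 0 ≤ b := norm_nonneg _
  have hab : b < a := lt_of_pow_lt_pow_left₀ 2 ha0 (sub_pos.1 hd)
  rw [← ENNReal.ofReal_div_of_pos (sub_pos.2 hab)]
  congr 1
  rw [div_eq_iff (sub_pos.2 hab).ne']
  apply mul_left_cancel₀ (by linarith : a + b ≠ 0)
  linear_combination hs

theorem distortion_linearMap_le :
    distortion (m.linearMap n) ≤ ENNReal.ofReal (Real.exp (dist m.modulus n.modulus)) := by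
  refine iSup_le fun F => iSup_le fun hF => iSup_le fun z => iSup_le fun _ => ?_
  obtain ⟨c, hc⟩ := (m.isLift_linearMap n).exists_eq_add hF
  have h : fderiv ℝ F z = m.transition n := by
    rw [funext hc, fderiv_add_const]
    exact (m.transition n).fderiv
  rw [h, m.dilatation_transition n]

theorem almostSmooth_linearMap : AlmostSmooth (m.linearMap n) :=
  ⟨m.transition n, m.isLift_linearMap n, ∅, Set.finite_empty, fun _ _ =>
    (m.transition n).contDiff.contDiffAt⟩

/-- Grötzsch's inequality in the direction of maximal stretch. Both the squared stretch and the
ratio of covolumes contain the determinant of the transition, which cancels and leaves `exp h`. -/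
theorem le_distortion {g : Torus m.lattice ≃ₜ Torus n.lattice}
    (hg : m.RespectsMarkings n (g : C(_, _))) (hs : AlmostSmooth g) :
    ENNReal.ofReal (Real.exp (dist m.modulus n.modulus)) ≤ distortion g := by
  by_cases htop : distortion g = ⊤
  · rw [htop]; exact le_top
  obtain ⟨F, hF, E, hE, hsm⟩ := hs
  obtain ⟨A, hA⟩ := hF.exists_hasPeriods
  obtain rfl := (m.respectsMarkings_iff n (φ := (g : C(_, _))) hF hA).1 hg
  obtain ⟨v, hv, hv'⟩ := exists_norm_clm_apply_eq (m.transition n)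
  have h := groetzsch g hF hA hE hsm htop v
  rw [hv', hv, m.stretch_sq n, m.covolume_eq n, one_pow, mul_one, mul_assoc] at h
  rw [ENNReal.ofReal_le_iff_le_toReal htop]
  exact le_of_mul_le_mul_right h (mul_pos (m.det_transition_pos n)
    (ZLattice.covolume_pos m.lattice MeasureTheory.volume))

theorem teichDist_eq :
    teichDist m n = ((dist m.modulus n.modulus / 2 : ℝ) : EReal) := by
  have h : (⨅ (g : Torus m.lattice ≃ₜ Torus n.lattice)
      (_ : m.RespectsMarkings n (g : C(_, _))) (_ : AlmostSmooth g), distortion g) =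
      ENNReal.ofReal (Real.exp (dist m.modulus n.modulus)) := by
    refine le_antisymm ?_ ?_
    · exact iInf_le_of_le (m.linearMap n) (iInf_le_of_le (m.respectsMarkings_linearMap n)
        (iInf_le_of_le (m.almostSmooth_linearMap n) (m.distortion_linearMap_le n)))
    · exact le_iInf fun g => le_iInf fun hg => le_iInf fun hs => m.le_distortion n hg hs
  rw [teichDist, h, ENNReal.log_ofReal_of_pos (Real.exp_pos _), Real.log_exp, ← EReal.coe_mul]
  congr 1
  ring

end MarkedTorus

/-! ### The metric on Teichmüller space -/

namespace TeichmullerSpace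

/-- The modulus of a point of Teichmüller space. -/
def modulus : TeichmullerSpace → ℍ :=
  Quotient.lift MarkedTorus.modulus fun _ _ h => MarkedTorus.modulus_eq_of_equivalent h

theorem modulus_bijective : Function.Bijective modulus := by
  refine ⟨fun x y => ?_, fun τ =>
    ⟨(MarkedTorus.ofModulus τ).toTeich, MarkedTorus.modulus_ofModulus τ⟩⟩
  induction x using Quotient.inductionOn
  induction y using Quotient.inductionOn
  exact fun h => Quotient.sound (MarkedTorus.equivalent_of_modulus_eq h)

/-- Half the hyperbolic distance of the moduli. -/
def halfDist (x y : TeichmullerSpace) : ℝ := dist (modulus x) (modulus y) / 2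

/-- Half the hyperbolic distance as a metric on Teichmüller space. -/
abbrev halfMetric : MetricSpace TeichmullerSpace where
  dist := halfDist
  dist_self x := by simp [halfDist]
  dist_comm x y := by simp [halfDist, dist_comm]
  dist_triangle x y z := by
    have := dist_triangle (modulus x) (modulus y) (modulus z)
    simp only [halfDist]; linarith
  eq_of_dist_eq_zero {x y} h := by
    refine modulus_bijective.1 (dist_eq_zero.1 ?_)
    have h' : dist (modulus x) (modulus y) / 2 = 0 := h
    linarith

end TeichmullerSpace

end FlatTorus

end

theorem theorem1p1 :
    ∃ (lam dTeich : FlatTorus.TeichmullerSpace → FlatTorus.TeichmullerSpace → ℝ)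
      (Φ : FlatTorus.TeichmullerSpace ≃ ℍ),
      -- `λ` is real-valued and descends to Teichmüller space, where it is a (symmetric) metric
      (∀ m n : FlatTorus.MarkedTorus,
        FlatTorus.thurstonLambda m n = ((lam m.toTeich n.toTeich : ℝ) : EReal)) ∧
      (∃ M : MetricSpace FlatTorus.TeichmullerSpace, ∀ x y, M.dist x y = lam x y) ∧
      -- so does the Teichmüller distance
      (∀ m n : FlatTorus.MarkedTorus,
        FlatTorus.teichDist m n = ((dTeich m.toTeich n.toTeich : ℝ) : EReal)) ∧
      (∃ M : MetricSpace FlatTorus.TeichmullerSpace, ∀ x y, M.dist x y = dTeich x y) ∧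
      -- `Φ` is the usual identification with the upper half-plane
      (∀ m : FlatTorus.MarkedTorus, m.HasModulus (Φ m.toTeich : ℂ)) ∧
      -- the three metrics agree up to scalar factors, with these constants
      (∀ x y, dTeich x y = lam x y) ∧
      (∀ x y, dist (Φ x) (Φ y) = 2 * lam x y) := by
  refine ⟨FlatTorus.TeichmullerSpace.halfDist, FlatTorus.TeichmullerSpace.halfDist,
    Equiv.ofBijective FlatTorus.TeichmullerSpace.modulus
      FlatTorus.TeichmullerSpace.modulus_bijective,
    fun m n => m.thurstonLambda_eq n, ⟨FlatTorus.TeichmullerSpace.halfMetric, fun _ _ => rfl⟩,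
    fun m n => m.teichDist_eq n, ⟨FlatTorus.TeichmullerSpace.halfMetric, fun _ _ => rfl⟩,
    fun m => m.hasModulus_modulus, fun _ _ => rfl, fun x y => ?_⟩
  exact (mul_div_cancel₀ _ two_ne_zero).symm
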